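/- All Hilbert spaces are finite-dimensional, complex and nonzero, with a fixed (computational) orthonormal basis; $\mathcal L(\mathcal H)$ is the space of operators on $\mathcal H$. A quantum channel is a completely positive trace-preserving linear map. The Choi operator of a linear map $\mathcal E:\mathcal L(\mathcal H_I)\to\mathcal L(\mathcal H_O)$ is $E=\sum_{i,i'}|i\rangle\langle i'|\otimes\mathcal E(|i\rangle\langle i'|)$, the Choi vector of an operator $A:\mathcal H_I\to\mathcal H_O$ is $|A\rangle\rangle=\sum_i|i\rangle\otimes A|i\rangle$, and the link product of operators $E$ on $\mathcal H_0\otimes\mathcal H_1$ and $F$ on $\mathcal H_1\otimes\mathcal H_2$ is $E*F=\mathrm{Tr}_{\mathcal H_1}[(E\otimes 1)(1\otimes F^{T_{\mathcal H_1}})]$. Let $N\ge 1$ and let $\mathcal H_0,\dots,\mathcal H_{2N+1}$ be Hilbert spaces with $d_m=\dim\mathcal H_m$. The Choi operator of a linear supermap $$\mathcal W:\bigotimes_{n=1}^N[\mathcal L(\mathcal H_{2n-1})\to\mathcal L(\mathcal H_{2n})]\to[\mathcal L(\mathcal H_0)\to\mathcal L(\mathcal H_{2N+1})]$$ is the operator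 $W$ on $\bigotimes_{m=0}^{2N+1}\mathcal H_m$ such that $W*\bigotimes_nE_n$ is the Choi operator of $\mathcal W(\bigotimes_n\mathcal E_n)$ for all linear maps $\mathcal E_n$ with Choi operators $E_n$. * $\mathcal W$ is a quantum superchannel with $N$ slots if, for all auxiliary spaces $\mathcal H_1',\dots,\mathcal H_{2N}'$ and all channels $\mathcal E_n:\mathcal L(\mathcal H_{2n-1}\otimes\mathcal H_{2n-1}')\to\mathcal L(\mathcal H_{2n}\otimes\mathcal H_{2n}')$, $W*\bigotimes_nE_n$ is the Choi operator of a channel $\mathcal L(\mathcal H_0\otimes\bigotimes_n\mathcal H_{2n-1}')\to\mathcal L(\mathcal H_{2N+1}\otimes\bigotimes_n\mathcal H_{2n}')$. It is pure if, in addition, for all such auxiliary spaces and all unitaries $V_n:\mathcal H_{2n-1}\otimes\mathcal H_{2n-1}'\to\mathcal H_{2n}\otimes\mathcal H_{2n}'$, there is a unitary $G:\mathcal H_0\otimes\bigotimes_n\mathcal H_{2n-1}'\to\mathcal H_{2N+1}\otimes\bigotimes_n\mathcal H_{2n}'$ with $|G\rangle\rangle\langle\langle G|=W*\bigotimes_n|V_n\rangle\rangle\langle\langle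 V_n|$. * A quantum comb with $0$ slots is a quantum channel. Recursively, $\mathcal W$ is a quantum comb with $N\ge1$ slots if, for all auxiliary spaces $\mathcal H_1',\mathcal H_{2N}'$ and every quantum comb with $N-1$ slots $\mathcal S:\bigotimes_{n=1}^{N-1}[\mathcal L(\mathcal H_{2n})\to\mathcal L(\mathcal H_{2n+1})]\to[\mathcal L(\mathcal H_1\otimes\mathcal H_1')\to\mathcal L(\mathcal H_{2N}\otimes\mathcal H_{2N}')]$ with Choi operator $S$, $W*S$ is the Choi operator of a channel $\mathcal L(\mathcal H_0\otimes\mathcal H_1')\to\mathcal L(\mathcal H_{2N+1}\otimes\mathcal H_{2N}')$. * A pure comb is a quantum comb that is a pure superchannel. A unitary $U:\bigotimes_{n=0}^N\mathcal H_{2n}\to\bigotimes_{n=0}^N\mathcal H_{2n+1}$ represents it if its Choi operator is $|U\rangle\rangle\langle\langle U|$. **Theorem.** Let $U^{(N+1)}:\bigotimes_{n=0}^N\mathcal H_{2n}\to\bigotimes_{n=0}^N\mathcal H_{2n+1}$ be a unitary operator representing a pure quantum comb with $N$ slots. Then there exist integers $k_0,\dots,k_{N+1}\ge 0$ with $k_0=k_{N+1}=1$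 and $$d_{2n}k_n=d_{2n+1}k_{n+1}\qquad(0\le n\le N),$$ Hilbert spaces $\mathcal A_n$ with $\dim\mathcal A_n=k_n$ ($0\le n\le N+1$; $\mathcal A_0=\mathcal A_{N+1}=\mathbb C$), and unitary operators $U_n:\mathcal H_{2n}\otimes\mathcal A_n\to\mathcal H_{2n+1}\otimes\mathcal A_{n+1}$ ($0\le n\le N$) such that $$U^{(N+1)}=U_N\cdots U_1U_0,$$ where each $U_n$ acts trivially on all spaces other than $\mathcal H_{2n}\otimes\mathcal A_n$. -/

import Mathlib

open scoped Matrix Kronecker TensorProduct ComplexOrder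

/-!
Finite-dimensional Hilbert spaces are taken in their computational bases: the space with basis
labels `a` (a finite nonempty type) is `ℂ^a`, operators from `ℂ^a` to `ℂ^b` are matrices
`Matrix b a ℂ`, the tensor product of `ℂ^a` and `ℂ^b` has basis labels `a × b`, and the tensor
product of a family `ℂ^(a j)` has basis labels `∀ j, a j`.
-/

noncomputable section

namespace QComb

/-- `𝓛(ℂ^a)`, the operators on the Hilbert space with basis labels `a`. -/
abbrev Op (a : Type) := Matrix a a ℂ

/-- The linear maps `𝓛(ℂ^a) → 𝓛(ℂ^b)`. -/
abbrev OpMap (a b : Type) := Op a →ₗ[ℂ] Op b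

/-- Unitarity of an operator between two possibly different Hilbert spaces. -/
def IsUnitaryOp {a b : Type} [Fintype a] [Fintype b] [DecidableEq a] [DecidableEq b]
    (U : Matrix b a ℂ) : Prop :=
  Uᴴ * U = 1 ∧ U * Uᴴ = 1

/-! ### Channels and Choi operators -/

/-- The map `id_k ⊗ Φ` on `𝓛(ℂ^k ⊗ ℂ^a)`, that is, `Φ` applied to each `a`-block. -/
def ampliation (k : ℕ) {a b : Type} (Φ : OpMap a b) (ρ : Op (Fin k × a)) : Op (Fin k × b) :=
  Matrix.of fun r s => Φ (Matrix.of fun x y => ρ (r.1, x) (s.1, y)) r.2 s.2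

/-- Complete positivity: `id_k ⊗ Φ` preserves positive semidefiniteness for every `k`. -/
def IsCompletelyPositive {a b : Type} (Φ : OpMap a b) : Prop :=
  ∀ (k : ℕ) (ρ : Op (Fin k × a)), ρ.PosSemidef → (ampliation k Φ ρ).PosSemidef

/-- Quantum channels: completely positive trace-preserving maps. -/
def IsChannel {a b : Type} [Fintype a] [Fintype b] (Φ : OpMap a b) : Prop :=
  IsCompletelyPositive Φ ∧ ∀ ρ : Op a, (Φ ρ).trace = ρ.trace

/-- The Choi operator `∑ |i⟩⟨i'| ⊗ Φ(|i⟩⟨i'|)` of a map. -/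
def choi {a b : Type} [DecidableEq a] (Φ : OpMap a b) : Op (a × b) :=
  Matrix.of fun r s => Φ (Matrix.single r.1 s.1 1) r.2 s.2

/-- The Choi vector `|A⟩⟩ = ∑ |i⟩ ⊗ A|i⟩` of an operator. -/
def choiVec {a b : Type} (A : Matrix b a ℂ) : a × b → ℂ := fun r => A r.2 r.1

/-- The rank-one operator `|A⟩⟩⟨⟨A|`. -/
def choiOp {a b : Type} (A : Matrix b a ℂ) : Op (a × b) :=
  Matrix.vecMulVec (choiVec A) (star (choiVec A))

/-- The link product `E * F = Tr_b[(E ⊗ 1)(1 ⊗ F^{T_b})]` over the shared system `b`, in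
coordinates. -/
def link {a b c : Type} [Fintype b] (E : Op (a × b)) (F : Op (b × c)) : Op (a × c) :=
  Matrix.of fun r s => ∑ x, ∑ y, E (r.1, x) (s.1, y) * F (x, r.2) (y, s.2)

/-! ### Supermaps with `N` slots

The global past is `P`, the global future is `F`, and the `j`-th slot takes maps
`𝓛(ℂ^(I j)) → 𝓛(ℂ^(O j))`. -/

/-- Supermaps `⨂_j [𝓛(I j) → 𝓛(O j)] → [𝓛(P) → 𝓛(F)]`. -/
abbrev Supermap {N : ℕ} (P F : Type) (I O : Fin N → Type) :=
  (⨂[ℂ] j, OpMap (I j) (O j)) →ₗ[ℂ] OpMap P F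

/-- Basis labels of the tensor product of all systems of a supermap; the systems `P`, `O j` (the
inputs of the map that represents the supermap) come first, then its outputs `I j`, `F`. -/
abbrev CombIdx {N : ℕ} (P F : Type) (I O : Fin N → Type) : Type :=
  (P × (∀ j, O j)) × ((∀ j, I j) × F)

/-- The map `ρ ↦ ⟨i|ρ|i'⟩ |o⟩⟨o'|`, whose Choi operator is `|i⟩⟨i'| ⊗ |o⟩⟨o'|`. -/
def unitMap {a b : Type} [DecidableEq b] (i i' : a) (o o' : b) : OpMap a b :=
  (Matrix.entryLinearMap ℂ ℂ i i').smulRight (Matrix.single o o' (1 : ℂ))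

/-- The Choi operator of a supermap: the operator `W` such that the Choi operator of
`𝓦(⨂_j 𝓔_j)` is the link product of `W` with the tensor product of the Choi operators of
the `𝓔_j`. -/
def supermapChoi {N : ℕ} {P F : Type} {I O : Fin N → Type} [DecidableEq P]
    [∀ j, DecidableEq (O j)] (𝓦 : Supermap P F I O) : Op (CombIdx P F I O) :=
  Matrix.of fun r s =>
    𝓦 (PiTensorProduct.tprod ℂ fun j => unitMap (r.2.1 j) (s.2.1 j) (r.1.2 j) (s.1.2 j))
      (Matrix.single r.1.1 s.1.1 1) r.2.2 s.2.2

/-- `W` with its systems grouped as (outer systems `P`, `F`) ⊗ (slot systems `I j`, `O j`). -/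
def outerInner {N : ℕ} {P F : Type} {I O : Fin N → Type} (W : Op (CombIdx P F I O)) :
    Op ((P × F) × ((∀ j, I j) × (∀ j, O j))) :=
  W.submatrix (fun r => ((r.1.1, r.2.2), (r.2.1, r.1.2)))
    (fun r => ((r.1.1, r.2.2), (r.2.1, r.1.2)))

/-- `⨂_j C_j` for operators `C_j` on `I j ⊗ A j ⊗ O j ⊗ B j`, with the slot systems first and
the auxiliary systems last. -/
def tensorSlots {N : ℕ} {I O A B : Fin N → Type}
    (C : ∀ j, Op ((I j × A j) × (O j × B j))) :
    Op (((∀ j, I j) × (∀ j, O j)) × ((∀ j, A j) × (∀ j, B j))) :=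
  Matrix.of fun r s => ∏ j,
    C j ((r.1.1 j, r.2.1 j), (r.1.2 j, r.2.2 j)) ((s.1.1 j, s.2.1 j), (s.1.2 j, s.2.2 j))

/-- The link product `W * ⨂_j C_j`. -/
def insertSlots {N : ℕ} {P F : Type} {I O A B : Fin N → Type}
    [∀ j, Fintype (I j)] [∀ j, Fintype (O j)]
    (W : Op (CombIdx P F I O)) (C : ∀ j, Op ((I j × A j) × (O j × B j))) :
    Op ((P × (∀ j, A j)) × (F × (∀ j, B j))) :=
  (link (outerInner W) (tensorSlots C)).submatrix
    (fun r => ((r.1.1, r.2.1), (r.1.2, r.2.2))) (fun r => ((r.1.1, r.2.1), (r.1.2, r.2.2)))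

/-- `W` is the Choi operator of a quantum superchannel with `N` slots: it sends all tensor
products of quantum channels, acting also on auxiliary systems, to quantum channels. -/
def IsSuperchannel {N : ℕ} {P F : Type} {I O : Fin N → Type}
    [Fintype P] [DecidableEq P] [Fintype F]
    [∀ j, Fintype (I j)] [∀ j, DecidableEq (I j)] [∀ j, Fintype (O j)]
    (W : Op (CombIdx P F I O)) : Prop :=
  ∀ (A B : Fin N → Type) [∀ j, Fintype (A j)] [∀ j, DecidableEq (A j)] [∀ j, Nonempty (A j)]
    [∀ j, Fintype (B j)] [∀ j, DecidableEq (B j)] [∀ j, Nonempty (B j)]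
    (𝓔 : ∀ j, OpMap (I j × A j) (O j × B j)), (∀ j, IsChannel (𝓔 j)) →
    ∃ 𝓖 : OpMap (P × (∀ j, A j)) (F × (∀ j, B j)),
      IsChannel 𝓖 ∧ choi 𝓖 = insertSlots W fun j => choi (𝓔 j)

/-- `W` is the Choi operator of a pure superchannel with `N` slots: a superchannel that sends all
tensor products of unitary channels, acting also on auxiliary systems, to unitary channels. -/
def IsPureSuperchannel {N : ℕ} {P F : Type} {I O : Fin N → Type}
    [Fintype P] [DecidableEq P] [Fintype F] [DecidableEq F]
    [∀ j, Fintype (I j)] [∀ j, DecidableEq (I j)] [∀ j, Fintype (O j)] [∀ j, DecidableEq (O j)]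
    (W : Op (CombIdx P F I O)) : Prop :=
  IsSuperchannel W ∧
  ∀ (A B : Fin N → Type) [∀ j, Fintype (A j)] [∀ j, DecidableEq (A j)] [∀ j, Nonempty (A j)]
    [∀ j, Fintype (B j)] [∀ j, DecidableEq (B j)] [∀ j, Nonempty (B j)]
    (V : ∀ j, Matrix (O j × B j) (I j × A j) ℂ), (∀ j, IsUnitaryOp (V j)) →
    ∃ G : Matrix (F × (∀ j, B j)) (P × (∀ j, A j)) ℂ,
      IsUnitaryOp G ∧ choiOp G = insertSlots W fun j => choiOp (V j)

/-! ### Quantum combs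

In an `(N+1)`-slot comb with slots `I j → O j`, `j = 0, …, N`, one inserts an `N`-slot comb whose
past is `I 0 ⊗ A`, whose slots are `O j → I (j+1)`, `j = 0, …, N-1`, and whose future is
`O N ⊗ B`, where `A` and `B` are auxiliary systems. -/

/-- Basis labels for the `N`-slot combs that are inserted in `(N+1)`-slot combs. -/
abbrev InnerIdx {N : ℕ} (I O : Fin (N + 1) → Type) (A B : Type) : Type :=
  CombIdx (I 0 × A) (O (Fin.last N) × B) (fun j : Fin N => O j.castSucc) (fun j : Fin N => I j.succ)

/-- An inserted comb `S` with its systems grouped as (all `I j`, all `O j`) ⊗ (auxiliary systems). -/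
def innerOuter {N : ℕ} {I O : Fin (N + 1) → Type} {A B : Type} (S : Op (InnerIdx I O A B)) :
    Op (((∀ j, I j) × (∀ j, O j)) × (A × B)) :=
  S.submatrix
    (fun r => (((r.1.1 0, r.2.1), fun j => r.1.1 j.succ),
      (fun j => r.1.2 j.castSucc, (r.1.2 (Fin.last N), r.2.2))))
    (fun r => (((r.1.1 0, r.2.1), fun j => r.1.1 j.succ),
      (fun j => r.1.2 j.castSucc, (r.1.2 (Fin.last N), r.2.2))))

/-- The link product `R * S` of an `(N+1)`-slot comb with an inserted `N`-slot comb. -/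
def insertComb {N : ℕ} {P F : Type} {I O : Fin (N + 1) → Type} {A B : Type}
    [∀ j, Fintype (I j)] [∀ j, Fintype (O j)]
    (R : Op (CombIdx P F I O)) (S : Op (InnerIdx I O A B)) : Op ((P × A) × (F × B)) :=
  (link (outerInner R) (innerOuter S)).submatrix
    (fun r => ((r.1.1, r.2.1), (r.1.2, r.2.2))) (fun r => ((r.1.1, r.2.1), (r.1.2, r.2.2)))

/-- `R` is the Choi operator of a quantum comb with `N` slots. With no slots, this is the Choi
operator of a quantum channel; with `N + 1` slots, it sends all quantum combs with `N` slots,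
acting also on auxiliary systems, to quantum channels. (A comb with one slot is thus a
superchannel with one slot.) -/
def IsComb : (N : ℕ) → (P F : Type) → (I O : Fin N → Type) →
    [Fintype P] → [DecidableEq P] → [Fintype F] →
    [∀ j, Fintype (I j)] → [∀ j, DecidableEq (I j)] →
    [∀ j, Fintype (O j)] → [∀ j, DecidableEq (O j)] → Op (CombIdx P F I O) → Prop
  | 0, P, F, _, _, _, _, _, _, _, _, _, R =>
    ∃ 𝓒 : OpMap P F, IsChannel 𝓒 ∧
      choi 𝓒 = R.submatrix (fun r : P × F => ((r.1, fun j => j.elim0), (fun j => j.elim0, r.2)))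
        (fun r : P × F => ((r.1, fun j => j.elim0), (fun j => j.elim0, r.2)))
  | N + 1, P, F, I, O, _, _, _, _, _, _, _, R =>
    ∀ (A B : Type) [Fintype A] [DecidableEq A] [Nonempty A]
      [Fintype B] [DecidableEq B] [Nonempty B]
      (S : Op (InnerIdx I O A B)),
      IsComb N (I 0 × A) (O (Fin.last N) × B)
        (fun j : Fin N => O j.castSucc) (fun j : Fin N => I j.succ) S →
      ∃ 𝓖 : OpMap (P × A) (F × B), IsChannel 𝓖 ∧ choi 𝓖 = insertComb R S

/-- `R` is the Choi operator of a pure comb with `N` slots: a quantum comb that is a pure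
superchannel. -/
def IsPureComb {N : ℕ} {P F : Type} {I O : Fin N → Type}
    [Fintype P] [DecidableEq P] [Fintype F] [DecidableEq F]
    [∀ j, Fintype (I j)] [∀ j, DecidableEq (I j)] [∀ j, Fintype (O j)] [∀ j, DecidableEq (O j)]
    (R : Op (CombIdx P F I O)) : Prop :=
  IsComb N P F I O R ∧ IsPureSuperchannel R

/-! ### Circuits -/

/-- An operator `⨂_{n ≤ N} H (2n) → ⨂_{n ≤ N} H (2n+1)` with its systems grouped as past, slot
outputs `H (2j+2)`, slot inputs `H (2j+1)`, future. -/
def regroup {N : ℕ} {H : ℕ → Type}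
    (U : Matrix (∀ n : Fin (N + 1), H (2 * n + 1)) (∀ n : Fin (N + 1), H (2 * n)) ℂ) :
    Matrix ((∀ j : Fin N, H (2 * j + 1)) × H (2 * N + 1)) (H 0 × (∀ j : Fin N, H (2 * j + 2))) ℂ :=
  U.submatrix (fun r => Fin.snoc (α := fun n : Fin (N + 1) => H (2 * n + 1)) r.1 r.2)
    (fun c => Fin.cons (α := fun n : Fin (N + 1) => H (2 * n)) c.1 c.2)

/-- The product `V (n-1) ⋯ V 1 V 0`, in which each `V i : H (2i) ⊗ ℂ^(k i) → H (2i+1) ⊗ ℂ^(k (i+1))`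
acts trivially on all other systems, as an operator
`⨂_{i < n} H (2i) → (⨂_{i < n} H (2i+1)) ⊗ ℂ^(k n)`. Its first input memory, of dimension
`k 0 = 1`, is identified with `ℂ`. -/
def circuit {H : ℕ → Type} [∀ m, Fintype (H m)] [∀ m, DecidableEq (H m)] {k : ℕ → ℕ}
    (V : ∀ n, Matrix (H (2 * n + 1) × Fin (k (n + 1))) (H (2 * n) × Fin (k n)) ℂ) :
    (n : ℕ) → Matrix ((∀ i : Fin n, H (2 * i + 1)) × Fin (k n)) (∀ i : Fin n, H (2 * i)) ℂ
  | 0 => Matrix.of fun _ _ => 1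
  | n + 1 =>
    (((1 : Op (∀ i : Fin n, H (2 * i + 1))) ⊗ₖ V n) *
      (circuit V n ⊗ₖ (1 : Op (H (2 * n)))).submatrix
        (fun r : (∀ i : Fin n, H (2 * i + 1)) × (H (2 * n) × Fin (k n)) =>
          ((r.1, r.2.2), r.2.1)) id).submatrix
      (fun r => (fun i => r.1 i.castSucc, (r.1 (Fin.last n), r.2)))
      (fun c => (fun i => c i.castSucc, c (Fin.last n)))

end QComb

end

namespace QComb

/-! ### Positivity and channels -/

/-! Combs are exactly the positive operators with causal normalization (`combIffSequential`):
tracing out the last output leaves the identity on the last input, tensored with an operator of the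
same kind with one step fewer. For |U⟩⟩⟨⟨U| this yields positive operators W_0 = 1, …, W_{N+1} =
|U⟩⟩⟨⟨U| on the first n inputs and outputs, with Tr_{H(2n+1)} W_{n+1} = 1_{H(2n)} ⊗ W_n
(`exists_reductions`).

Write W_n = X_n X_nᴴ with X_n injective on a memory A_n. Both X_{n+1} and 1 ⊗ X_n purify 1 ⊗ W_n,
and the second has injective memory, so they differ by an isometry H(2n) ⊗ A_n → H(2n+1) ⊗ A_{n+1}
(`exists_step`). W_0 and W_{N+1} have rank one, so the end memories are trivial and the isometries
compose to U. Each isometry gives d_{2n} k_n ≤ d_{2n+1} k_{n+1}. In the product over n the k's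
cancel, and unitarity of U forces equality, so every inequality is an equality and every isometry is
unitary (`dim_eq_of_dim_le`).

In the characterization, causal normalization makes contractions with inserted combs collapse one
system at a time (`sum_mul_of_sequential`). Conversely, a comb can be tested with wires (`feed`)
that expose its action on an arbitrary channel closing the last slot. Normalization of all the
results is a linear condition, which `eq_of_constant_on_channels` turns into the first causality
condition. The remaining conditions follow by induction, since discarding the last slot leaves a
smaller comb (`extend`). -/

lemma posSemidef_vec_mul_star {a : Type} (v : a → ℂ) :
    (Matrix.of fun x y => v x * star (v y) : Op a).PosSemidef := by
  refine ⟨?_, fun x => ?_⟩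
  · ext i j; simp [mul_comm]
  · have : (x.sum fun i xi => x.sum fun j xj =>
        star xi * (Matrix.of fun x y => v x * star (v y) : Op a) i j * xj) =
        (x.sum fun i xi => star xi * v i) * star (x.sum fun i xi => star xi * v i) := by
      simp only [Finsupp.sum, star_sum, Finset.sum_mul_sum, Matrix.of_apply, star_mul', star_star]
      refine Finset.sum_congr rfl fun i _ => Finset.sum_congr rfl fun j _ => ?_
      ring
    rw [this]
    exact mul_star_self_nonneg _

/-- Compressing a positive operator with a vector of the summed-over system. -/
lemma posSemidef_sum_sum {a x : Type} [Fintype a] [Fintype x] (M : Op (a × x)) (hM : M.PosSemidef) :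
    (Matrix.of fun r s => ∑ i, ∑ j, M (r, i) (s, j) : Op a).PosSemidef := by
  classical
  have h := hM.mul_mul_conjTranspose_same
    (Matrix.of fun r s => if r = s.1 then 1 else 0 : Matrix a (a × x) ℂ)
  convert h using 1
  ext r s
  simp only [Matrix.of_apply, Matrix.mul_apply, Matrix.conjTranspose_apply]
  rw [Finset.sum_comm]
  have h1 : ∀ j : a × x, (∑ i, (if r = i.1 then (1 : ℂ) else 0) * M i j) = ∑ i, M (r, i) j := by
    intro j
    rw [Fintype.sum_prod_type, Finset.sum_eq_single r]
    · simp
    · intro b _ hb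
      simp [hb.symm]
    · simp
  simp only [h1]
  rw [Fintype.sum_prod_type, Finset.sum_eq_single s]
  · simp
  · intro b _ hb
    simp [hb.symm]
  · simp

lemma posSemidef_sum_diag {a x : Type} [Fintype a] [Fintype x] (M : Op (a × x))
    (hM : M.PosSemidef) : (Matrix.of fun r s => ∑ i, M (r, i) (s, i) : Op a).PosSemidef := by
  classical
  have : (Matrix.of fun r s => ∑ i, M (r, i) (s, i) : Op a) =
      ∑ i, M.submatrix (fun r => (r, i)) (fun r => (r, i)) := by
    ext r s; simp [Matrix.sum_apply]
  rw [this]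
  exact Matrix.posSemidef_sum _ fun i _ => hM.submatrix _

/-- By Schur's product theorem the entrywise product of the two operators, pulled back to all three
systems, is positive. The link product is its compression by the all-ones vector of the shared
system. -/
lemma link_posSemidef {a b c : Type} [Fintype a] [Fintype b] [Fintype c] {E : Op (a × b)}
    {F : Op (b × c)} (hE : E.PosSemidef) (hF : F.PosSemidef) : (link E F).PosSemidef := by
  have h := posSemidef_sum_sum _ ((hE.submatrix (fun r : (a × c) × b => (r.1.1, r.2))).hadamard
    (hF.submatrix (fun r : (a × c) × b => (r.2, r.1.2))))
  exact h

/-- Choi's theorem: the Choi operators of channels are the positive operators whose partial trace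
over the output is the identity. -/
theorem exists_channel_iff {a b : Type} [Fintype a] [DecidableEq a] [Fintype b] (C : Op (a × b)) :
    (∃ 𝓖 : OpMap a b, IsChannel 𝓖 ∧ choi 𝓖 = C) ↔
      C.PosSemidef ∧ ∀ x x', ∑ y, C (x, y) (x', y) = if x = x' then 1 else 0 := by
  constructor
  · rintro ⟨𝓖, ⟨hcp, htp⟩, rfl⟩
    constructor
    · let e := Fintype.equivFin a
      -- The Choi operator is the image of the unnormalized maximally entangled state, with `Fin
      -- (card a)` as the reference copy of `a`.
      have h := hcp _ _ (posSemidef_vec_mul_star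
        (fun r : Fin (Fintype.card a) × a => if e.symm r.1 = r.2 then 1 else 0))
      have h2 := h.submatrix (fun r : a × b => (e r.1, r.2))
      convert h2 using 1
      ext r s
      simp only [choi, ampliation, Matrix.of_apply, Matrix.submatrix_apply]
      refine congrArg (fun M : Op a => 𝓖 M r.2 s.2) ?_
      ext x y
      by_cases h : r.1 = x <;> simp [Matrix.single_apply, h]
    · intro x x'
      have := htp (Matrix.single x x' 1)
      rcases eq_or_ne x x' with rfl | hx
      · simpa [Matrix.trace, choi] using this
      · rw [Matrix.trace_single_eq_of_ne _ _ _ hx] at this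
        simpa [Matrix.trace, choi, hx] using this
  · rintro ⟨hC, hT⟩
    refine ⟨{ toFun := fun ρ => Matrix.of fun y y' => ∑ x, ∑ x', ρ x x' * C (x, y) (x', y')
              map_add' := ?_, map_smul' := ?_ }, ⟨?_, ?_⟩, ?_⟩
    · intro ρ σ; ext; simp [add_mul, Finset.sum_add_distrib]
    · intro c ρ; ext; simp [Finset.mul_sum, mul_assoc]
    · intro k ρ hρ
      -- The ampliation of this map sends `ρ` to the link product of `ρ` with `C`, by definition.
      exact link_posSemidef hρ hC
    · intro ρ
      simp only [LinearMap.coe_mk, AddHom.coe_mk, Matrix.trace, Matrix.diag_apply, Matrix.of_apply]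
      rw [Finset.sum_comm]
      refine Finset.sum_congr rfl fun x _ => ?_
      rw [Finset.sum_comm]
      simp [← Finset.mul_sum, hT]
    · ext r s
      simp [choi, Matrix.single_apply, ite_and]

/-! ### Sequential operators -/

lemma sum_snoc {n : ℕ} {α : Fin (n + 1) → Type} [∀ i, Fintype (α i)] {M : Type} [AddCommMonoid M]
    (g : (∀ i, α i) → M) :
    ∑ f, g f = ∑ f : ∀ i : Fin n, α i.castSucc, ∑ x, g (Fin.snoc f x) := by
  rw [← (Fin.snocEquiv α).sum_comp, Fintype.sum_prod_type, Finset.sum_comm]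
  rfl

/-- The partial trace of an operator over its future. -/
def traceFuture {N : ℕ} {P F : Type} {I O : Fin N → Type} [Fintype F] (R : Op (CombIdx P F I O)) :
    Op ((P × ∀ j, O j) × ∀ j, I j) :=
  Matrix.of fun r s => ∑ f, R (r.1, (r.2, f)) (s.1, (s.2, f))

/-- The causal normalization of a comb whose future is traced out: the last input is uncorrelated,
and after removing it and tracing out the last output the same holds. -/
def Sequential : (N : ℕ) → (P : Type) → (I O : Fin N → Type) → [DecidableEq P] →
    [∀ j, Fintype (I j)] → [∀ j, DecidableEq (O j)] → Op ((P × ∀ j, O j) × ∀ j, I j) → Prop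
  | 0, _, _, _, _, _, _, T => ∀ r s, T r s = if r.1.1 = s.1.1 then 1 else 0
  | N + 1, P, I, O, _, _, _, T =>
    ∃ R : Op ((P × ∀ j : Fin N, O j.castSucc) × ∀ j, I j),
      (∀ p o i p' o' i', T ((p, o), i) ((p', o'), i') =
        if o (Fin.last N) = o' (Fin.last N) then
          R ((p, fun j => o j.castSucc), i) ((p', fun j => o' j.castSucc), i') else 0) ∧
      Sequential N P (fun j => I j.castSucc) (fun j => O j.castSucc)
        (Matrix.of fun r s => ∑ x, R (r.1, Fin.snoc r.2 x) (s.1, Fin.snoc s.2 x))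

/-- Model of a wiring in which `g j` reads the `j`-th slot input off the past and every slot output
is discarded. The hypothesis on `K` says that tracing out all these read-offs leaves the identity on
the past. -/
lemma sequential_of_delta (N : ℕ) : ∀ (Q : Type) (X Y : Fin N → Type) [DecidableEq Q]
    [∀ j, Fintype (X j)] [∀ j, DecidableEq (X j)] [∀ j, DecidableEq (Y j)]
    (g : ∀ j, Q → X j) (K : Op Q) (_ : ∀ q q', (if ∀ j, g j q = g j q' then K q q' else 0) =
      if q = q' then 1 else 0),
    Sequential N Q X Y (Matrix.of fun r s =>
      if (∀ j, r.2 j = g j r.1.1) ∧ (∀ j, s.2 j = g j s.1.1) ∧ ∀ j, r.1.2 j = s.1.2 j then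
        K r.1.1 s.1.1 else 0) := by
  induction N with
  | zero =>
    intro Q X Y _ _ _ _ g K hK r s
    simpa using hK r.1.1 s.1.1
  | succ N ih =>
    intro Q X Y _ _ _ _ g K hK
    refine ⟨Matrix.of fun r s => if (∀ j, r.2 j = g j r.1.1) ∧ (∀ j, s.2 j = g j s.1.1) ∧
      ∀ j, r.1.2 j = s.1.2 j then K r.1.1 s.1.1 else 0, ?_, ?_⟩
    · intro p o i p' o' i'
      simp only [Matrix.of_apply, Fin.forall_fin_succ' (P := fun j => o j = o' j), ← ite_and]
      congr 1
      simp only [eq_iff_iff]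
      tauto
    -- Tracing out the last slot input forces `g` to agree on `q` and `q'`; this condition is
    -- absorbed into `K`.
    · have := ih Q (fun j => X j.castSucc) (fun j => Y j.castSucc) (fun j => g j.castSucc)
        (Matrix.of fun q q' => if g (Fin.last N) q = g (Fin.last N) q' then K q q' else 0) ?_
      · convert this using 1
        ext r s
        simp only [Matrix.of_apply, Fin.forall_fin_succ', Fin.snoc_castSucc, Fin.snoc_last]
        rw [← ite_and, Finset.sum_eq_single (g (Fin.last N) r.1.1)]
        · congr 1
          simp only [eq_iff_iff]
          tauto
        · intro x _ hx
          rw [if_neg]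
          tauto
        · simp
      · intro q q'
        rw [← hK q q', Matrix.of_apply, ← ite_and]
        exact if_congr (Fin.forall_fin_succ' (P := fun j => g j q = g j q')).symm rfl rfl

/-- Contracting a sequential operator with a sequential operator that interleaves with it. -/
lemma sum_mul_of_sequential (N : ℕ) : ∀ (P A : Type) (I : Fin (N + 1) → Type) (O : Fin N → Type)
    [DecidableEq P] [DecidableEq A] [∀ j, Fintype (I j)] [∀ j, DecidableEq (I j)]
    [∀ j, Fintype (O j)] [∀ j, DecidableEq (O j)]
    (R : Op ((P × ∀ j, O j) × ∀ j, I j))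
    (Q : Op (((I 0 × A) × ∀ j : Fin N, I j.succ) × ∀ j, O j))
    (_ : Sequential N P (fun j => I j.castSucc) O
      (Matrix.of fun r s => ∑ x, R (r.1, Fin.snoc r.2 x) (s.1, Fin.snoc s.2 x)))
    (_ : Sequential N (I 0 × A) O (fun j => I j.succ) Q) (p p' : P) (a a' : A),
    ∑ i, ∑ i', ∑ o, ∑ o', R ((p, o), i) ((p', o'), i') *
      Q (((i 0, a), fun j => i j.succ), o) (((i' 0, a'), fun j => i' j.succ), o') =
    if p = p' ∧ a = a' then 1 else 0 := by
  induction N with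
  | zero =>
    intro P A I O _ _ _ _ _ _ R Q hR hQ p p' a a'
    have h1 := hR ((p, default), default) ((p', default), default)
    simp only [Matrix.of_apply] at h1
    simp only [sum_snoc (α := I), Fintype.sum_unique, hQ _ _, Prod.mk.injEq, mul_ite, mul_one,
      mul_zero]
    have h0 : ∀ x : I (Fin.last 0), (Fin.snoc (default : ∀ j : Fin 0, I j.castSucc) x :
      ∀ j, I j) 0 = x := fun x => Fin.snoc_last (α := I) x default
    simp only [h0, ite_and]
    by_cases ha : a = a'
    · simp only [ha, if_true]
      rw [← h1]
      refine Finset.sum_congr rfl fun x _ => ?_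
      rw [Finset.sum_eq_single x]
      · exact if_pos rfl
      · intro y _ hy
        exact if_neg hy.symm
      · simp
    · simp [ha]
  | succ N ih =>
    intro P A I O _ _ _ _ _ _ R Q hR hQ p p' a a'
    obtain ⟨R', hR', hRs⟩ := hR
    obtain ⟨Q', hQ', hQs⟩ := hQ
    have key := ih P A (fun j => I j.castSucc) (fun j => O j.castSucc) R' _ hRs hQs p p' a a'
    have hQ2 : ∀ f x f' x' o o',
        Q ((((Fin.snoc f x : ∀ j, I j) 0, a), fun j => (Fin.snoc f x : ∀ j, I j) j.succ), o)
          ((((Fin.snoc f' x' : ∀ j, I j) 0, a'), fun j => (Fin.snoc f' x' : ∀ j, I j) j.succ), o') =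
        if x = x' then Q' (((f 0, a), fun j => f j.succ), o) (((f' 0, a'), fun j => f' j.succ), o')
        else 0 := by
      intro f x f' x' o o'
      have h0 : ∀ f x, (Fin.snoc f x : ∀ j, I j) 0 = f 0 :=
        fun f x => Fin.snoc_castSucc (α := I) x f 0
      have hs : ∀ f x (j : Fin N), (Fin.snoc f x : ∀ j, I j) j.castSucc.succ = f j.succ :=
        fun f x j => Fin.snoc_castSucc (α := I) x f j.succ
      have hl : ∀ f x, (Fin.snoc f x : ∀ j, I j) (Fin.last N).succ = x :=
        fun f x => Fin.snoc_last (α := I) x f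
      rw [hQ', hl, hl, h0, h0]
      simp only [hs]
    have hR2 : ∀ o f o' f', ∑ x, R ((p, o), Fin.snoc f x) ((p', o'), Fin.snoc f' x) =
        if o (Fin.last N) = o' (Fin.last N) then
          R' ((p, fun j => o j.castSucc), f) ((p', fun j => o' j.castSucc), f') else 0 :=
      fun o f o' f' => hR' p o f p' o' f'
    -- The delta at the top of `Q` traces out the last `I` system of `R`. This produces a delta in
    -- the last `O` system of `R`, which in turn traces out that system of `Q'`, leaving the
    -- contraction one level down.
    calc _ = ∑ f, ∑ f', ∑ o, ∑ o', (∑ x, R ((p, o), Fin.snoc f x) ((p', o'), Fin.snoc f' x)) *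
          Q' (((f 0, a), fun j => f j.succ), o) (((f' 0, a'), fun j => f' j.succ), o') := by
            simp only [sum_snoc (α := I), hQ2, mul_ite, mul_zero, Finset.sum_mul]
            refine Finset.sum_congr rfl fun f _ => ?_
            rw [Finset.sum_comm]
            refine Finset.sum_congr rfl fun f' _ => ?_
            simp only [Finset.sum_ite_irrel, Finset.sum_const_zero, Finset.sum_ite_eq,
              Finset.mem_univ, if_true]
            rw [Finset.sum_comm]
            refine Finset.sum_congr rfl fun o _ => ?_
            rw [Finset.sum_comm]
      _ = _ := by
        rw [← key]
        refine Finset.sum_congr rfl fun f _ => Finset.sum_congr rfl fun f' _ => ?_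
        simp only [hR2, sum_snoc (α := O), Fin.snoc_last, Fin.snoc_castSucc, ite_mul, zero_mul]
        refine Finset.sum_congr rfl fun u _ => ?_
        rw [Finset.sum_comm]
        refine Finset.sum_congr rfl fun u' _ => ?_
        simp only [Finset.sum_ite_eq, Finset.mem_univ, if_true]
        exact (Finset.mul_sum _ _ _).symm

/-! ### Combs are the positive operators with causal normalization -/

/-- Polarization: evaluating at v + w and v + iw separates the two mixed terms, so the whole
sesquilinear form vanishes. -/
lemma eq_zero_of_quadratic {z : Type} [Fintype z] [DecidableEq z] (t : z → z → ℂ)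
    (h : ∀ v : z → ℂ, ∑ r, ∑ s, t r s * (v r * star (v s)) = 0) (r s : z) : t r s = 0 := by
  have hB : ∀ v w : z → ℂ, ∑ r, ∑ s, t r s * (v r * star (w s)) = 0 := by
    intro v w
    have h1 := h (v + w)
    have h2 := h (v + Complex.I • w)
    have e1 : ∑ r, ∑ s, t r s * ((v + w) r * star ((v + w) s)) =
        (∑ r, ∑ s, t r s * (v r * star (v s))) + (∑ r, ∑ s, t r s * (v r * star (w s))) +
        (∑ r, ∑ s, t r s * (w r * star (v s))) + (∑ r, ∑ s, t r s * (w r * star (w s))) := by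
      simp only [← Finset.sum_add_distrib]
      refine Finset.sum_congr rfl fun r _ => Finset.sum_congr rfl fun s _ => ?_
      simp only [Pi.add_apply, star_add]
      ring
    have e2 : ∑ r, ∑ s, t r s * ((v + Complex.I • w) r * star ((v + Complex.I • w) s)) =
        (∑ r, ∑ s, t r s * (v r * star (v s))) -
        Complex.I * (∑ r, ∑ s, t r s * (v r * star (w s))) +
        Complex.I * (∑ r, ∑ s, t r s * (w r * star (v s))) +
        (∑ r, ∑ s, t r s * (w r * star (w s))) := by
      simp only [← Finset.sum_add_distrib, ← Finset.sum_sub_distrib, Finset.mul_sum]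
      refine Finset.sum_congr rfl fun r _ => Finset.sum_congr rfl fun s _ => ?_
      simp only [Pi.add_apply, star_add, Pi.smul_apply, smul_eq_mul, star_mul', Complex.star_def,
        Complex.conj_I]
      linear_combination (- t r s * w r * (starRingEnd ℂ) (w s)) * Complex.I_mul_I
    rw [e1, h v, h w] at h1
    rw [e2, h v, h w] at h2
    have h3 : Complex.I * (2 * ∑ r, ∑ s, t r s * (v r * star (w s))) = 0 := by
      linear_combination Complex.I * h1 - h2
    simpa using h3
  have h4 := hB (Pi.single r 1) (Pi.single s 1)
  rw [Finset.sum_eq_single r, Finset.sum_eq_single s] at h4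
  · simpa using h4
  · intro b _ hb; simp [hb]
  · simp
  · intro b _ hb; simp [hb]
  · simp

/-- With l = ‖v‖², the Hermitian operator M = l·1 − vvᴴ satisfies M² = lM, so M = l⁻¹ M Mᴴ when l ≠
0. -/
lemma posSemidef_norm_smul_one_sub {x : Type} [Fintype x] [DecidableEq x] (v : x → ℂ) :
    ((∑ i, v i * star (v i)) • (1 : Op x) -
      (Matrix.of fun i j => v i * star (v j) : Op x)).PosSemidef := by
  set l := ∑ i, v i * star (v i) with hl
  set M := l • (1 : Op x) - (Matrix.of fun i j => v i * star (v j) : Op x) with hM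
  have hl0 : 0 ≤ l := Finset.sum_nonneg fun i _ => mul_star_self_nonneg _
  rcases eq_or_ne l 0 with hl1 | hl1
  · have hv : ∀ r, v r = 0 := by
      intro r
      have := (Finset.sum_eq_zero_iff_of_nonneg fun i _ => mul_star_self_nonneg (v i)).1 hl1 r
        (Finset.mem_univ r)
      simpa using this
    have : M = 0 := by
      ext i j; simp [hM, hl1, hv]
    rw [this]
    exact Matrix.PosSemidef.zero
  · have hstar : star l = l := (IsSelfAdjoint.of_nonneg hl0).star_eq
    have hH : Mᴴ = M := by
      ext i j
      simp only [hM, Matrix.conjTranspose_apply, Matrix.sub_apply, Matrix.smul_apply,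
        Matrix.of_apply, smul_eq_mul, star_sub, star_mul', star_star, hstar, Matrix.one_apply,
        apply_ite star, star_one, star_zero, eq_comm (a := j)]
      ring
    have hP : (Matrix.of fun i j => v i * star (v j) : Op x) *
        (Matrix.of fun i j => v i * star (v j) : Op x) =
        l • (Matrix.of fun i j => v i * star (v j) : Op x) := by
      ext i j
      simp only [Matrix.mul_apply, Matrix.of_apply, Matrix.smul_apply, smul_eq_mul, hl,
        Finset.sum_mul]
      refine Finset.sum_congr rfl fun k _ => ?_
      ring
    have hMM : M = l⁻¹ • (M * Mᴴ) := by
      rw [eq_inv_smul_iff₀ hl1, hH]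
      simp only [hM, mul_sub, sub_mul, hP, smul_mul_assoc, mul_smul_comm, one_mul, mul_one,
        smul_sub]
      abel
    rw [hMM]
    exact (Matrix.posSemidef_self_mul_conjTranspose M).smul (inv_nonneg.2 hl0)

/-- The partial trace of a pure state, subtracted from a multiple of the identity. -/
lemma posSemidef_norm_smul_one_sub_trace {x y : Type} [Fintype x] [DecidableEq x] [Fintype y]
    (v : x × y → ℂ) :
    ((∑ r, v r * star (v r)) • (1 : Op x) -
      (Matrix.of fun i j => ∑ o, v (i, o) * star (v (j, o)) : Op x)).PosSemidef := by
  have h := Matrix.posSemidef_sum Finset.univ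
    fun (o : y) _ => posSemidef_norm_smul_one_sub fun i => v (i, o)
  convert h using 1
  ext i j
  simp only [Matrix.sub_apply, Matrix.smul_apply, Matrix.sum_apply, Matrix.of_apply,
    Finset.sum_sub_distrib, smul_eq_mul, ← Finset.sum_mul]
  rw [Fintype.sum_prod_type, Finset.sum_comm]

/-- A linear functional that is constant on the Choi operators of channels only sees the partial
trace over the output. -/
lemma eq_of_constant_on_channels {x y : Type} [Fintype x] [DecidableEq x] [Fintype y]
    [DecidableEq y] (t : x × y → x × y → ℂ) (c : ℂ) (y₀ : y)
    (h : ∀ X : Op (x × y), X.PosSemidef →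
      (∀ i i', ∑ o, X (i, o) (i', o) = if i = i' then 1 else 0) → ∑ r, ∑ s, t r s * X r s = c) :
    (∀ i o i' o', t (i, o) (i', o') = if o = o' then t (i, y₀) (i', y₀) else 0) ∧
      ∑ i, t (i, y₀) (i, y₀) = c := by
  -- The basis state `y₀` serves to extend an operator `D` on `x` to D ⊗ |y₀⟩⟨y₀|, whose partial
  -- trace is again `D`.
  set w : x × y → ℂ := fun r => if r.2 = y₀ then 1 else 0 with hw
  have hext : ∀ D : Op x, D.PosSemidef →
      (Matrix.of fun r s => D r.1 s.1 * (w r * star (w s)) : Op (x × y)).PosSemidef :=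
    fun D hD => (hD.submatrix Prod.fst).hadamard (posSemidef_vec_mul_star w)
  have htr : ∀ (D : Op x) i i', ∑ o, D i i' * (w (i, o) * star (w (i', o))) = D i i' := by
    intro D i i'
    simp [hw]
  have hsum : ∀ (D : Op x), ∑ r, ∑ s, t r s * (D r.1 s.1 * (w r * star (w s))) =
      ∑ i, ∑ i', t (i, y₀) (i', y₀) * D i i' := by
    intro D
    simp [Fintype.sum_prod_type, hw, apply_ite star]
  have h1 : ∑ i, t (i, y₀) (i, y₀) = c := by
    rw [← h _ (hext 1 Matrix.PosSemidef.one) (fun i i' => by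
      simp only [Matrix.of_apply, htr]; rfl)]
    simp only [Matrix.of_apply, hsum]
    simp [Matrix.one_apply]
  refine ⟨fun i o i' o' => ?_, h1⟩
  rw [← sub_eq_zero]
  refine eq_zero_of_quadratic (fun r s => t r s - if r.2 = s.2 then t (r.1, y₀) (s.1, y₀) else 0)
    (fun v => ?_) (i, o) (i', o')
  set l := ∑ r, v r * star (v r) with hl
  have hl0 : 0 ≤ l := Finset.sum_nonneg fun i _ => mul_star_self_nonneg _
  set D : Op x := Matrix.of fun i j => ∑ o, v (i, o) * star (v (j, o)) with hD
  have goal' : ∑ r, ∑ s, (t r s - if r.2 = s.2 then t (r.1, y₀) (s.1, y₀) else 0) *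
      (v r * star (v s)) =
      (∑ r, ∑ s, t r s * (v r * star (v s))) - ∑ i, ∑ i', t (i, y₀) (i', y₀) * D i i' := by
    simp only [sub_mul, Finset.sum_sub_distrib]
    congr 1
    simp only [Fintype.sum_prod_type, ite_mul, zero_mul, Finset.sum_ite_eq, Finset.mem_univ,
      if_true, hD, Matrix.of_apply, Finset.mul_sum]
    refine Finset.sum_congr rfl fun i _ => ?_
    rw [Finset.sum_comm]
  rw [goal']
  rcases eq_or_ne l 0 with hl1 | hl1
  · have hv : ∀ r, v r = 0 := by
      intro r
      have := (Finset.sum_eq_zero_iff_of_nonneg fun i _ => mul_star_self_nonneg (v i)).1 hl1 r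
        (Finset.mem_univ r)
      simpa using this
    simp [hD, hv]
  -- Every vector v enters a channel: with D the partial trace of vvᴴ, the operator l⁻¹(vvᴴ + (l·1 −
  -- D) ⊗ |y₀⟩⟨y₀|) is positive with partial trace 1. Hence the functional agrees on vvᴴ and on D ⊗
  -- |y₀⟩⟨y₀|.
  · have hX := h (l⁻¹ • ((Matrix.of fun r s => v r * star (v s) : Op (x × y)) +
      (Matrix.of fun r s => (l • (1 : Op x) - D) r.1 s.1 * (w r * star (w s)) : Op (x × y))))
      (((posSemidef_vec_mul_star v).add (hext _ (posSemidef_norm_smul_one_sub_trace v))).smul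
        (inv_nonneg.2 hl0)) ?_
    · have e : ∑ r, ∑ s, t r s * (l⁻¹ • ((Matrix.of fun r s => v r * star (v s) : Op (x × y)) +
        (Matrix.of fun r s => (l • (1 : Op x) - D) r.1 s.1 * (w r * star (w s)) : Op (x × y)))) r s
        = l⁻¹ * ((∑ r, ∑ s, t r s * (v r * star (v s))) +
          ∑ i, ∑ i', t (i, y₀) (i', y₀) * (l • (1 : Op x) - D) i i') := by
        rw [← hsum, ← Finset.sum_add_distrib, Finset.mul_sum]
        refine Finset.sum_congr rfl fun r _ => ?_
        rw [← Finset.sum_add_distrib, Finset.mul_sum]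
        refine Finset.sum_congr rfl fun s _ => ?_
        simp only [Matrix.smul_apply, Matrix.add_apply, Matrix.of_apply, smul_eq_mul]
        ring
      have e2 : ∑ i, ∑ i', t (i, y₀) (i', y₀) * (l • (1 : Op x) - D) i i' =
          l * c - ∑ i, ∑ i', t (i, y₀) (i', y₀) * D i i' := by
        rw [← h1, Finset.mul_sum, ← Finset.sum_sub_distrib]
        refine Finset.sum_congr rfl fun i _ => ?_
        simp [mul_sub, Matrix.one_apply, mul_comm]
      rw [e, e2, inv_mul_eq_iff_eq_mul₀ hl1] at hX
      linear_combination hX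
    · intro i i'
      simp only [Matrix.smul_apply, Matrix.add_apply, Matrix.of_apply, smul_eq_mul,
        ← Finset.mul_sum, Finset.sum_add_distrib, htr]
      rw [inv_mul_eq_iff_eq_mul₀ hl1]
      simp [hD, Matrix.one_apply]

lemma traceFuture_insertComb {N : ℕ} {P F : Type} {I O : Fin (N + 1) → Type} {A B : Type}
    [∀ j, Fintype (I j)] [∀ j, Fintype (O j)] [Fintype F] [Fintype B]
    (R : Op (CombIdx P F I O)) (S : Op (InnerIdx I O A B)) (p p' : P) (a a' : A) :
    ∑ y, insertComb R S ((p, a), y) ((p', a'), y) =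
      ∑ i, ∑ i', ∑ o, ∑ o', traceFuture R ((p, o), i) ((p', o'), i') *
        ∑ b, S (((i 0, a), fun j => i j.succ), (fun j => o j.castSucc, (o (Fin.last N), b)))
          (((i' 0, a'), fun j => i' j.succ), (fun j => o' j.castSucc, (o' (Fin.last N), b))) := by
  have e : ∀ y, insertComb R S ((p, a), y) ((p', a'), y) =
      ∑ i, ∑ i', ∑ o, ∑ o', R ((p, o), (i, y.1)) ((p', o'), (i', y.1)) *
        S (((i 0, a), fun j => i j.succ), (fun j => o j.castSucc, (o (Fin.last N), y.2)))
          (((i' 0, a'), fun j => i' j.succ), (fun j => o' j.castSucc, (o' (Fin.last N), y.2))) := by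
    intro y
    simp only [insertComb, link, Matrix.submatrix_apply, Matrix.of_apply, Fintype.sum_prod_type]
    refine Finset.sum_congr rfl fun i _ => ?_
    rw [Finset.sum_comm]
    rfl
  simp only [e]
  rw [Finset.sum_comm]
  refine Finset.sum_congr rfl fun i _ => ?_
  rw [Finset.sum_comm]
  refine Finset.sum_congr rfl fun i' _ => ?_
  rw [Finset.sum_comm]
  refine Finset.sum_congr rfl fun o _ => ?_
  rw [Finset.sum_comm]
  refine Finset.sum_congr rfl fun o' _ => ?_
  simp only [Fintype.sum_prod_type, traceFuture, Matrix.of_apply, Finset.sum_mul_sum]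

lemma insertComb_posSemidef {N : ℕ} {P F : Type} {I O : Fin (N + 1) → Type} {A B : Type}
    [Fintype P] [Fintype F] [Fintype A] [Fintype B]
    [∀ j, Fintype (I j)] [∀ j, Fintype (O j)] {R : Op (CombIdx P F I O)}
    {S : Op (InnerIdx I O A B)} (hR : R.PosSemidef) (hS : S.PosSemidef) :
    (insertComb R S).PosSemidef :=
  (link_posSemidef (hR.submatrix _) (hS.submatrix _)).submatrix _

/-- The operator that supplies the first inputs of the slots from the past, sends all outputs of
the slots to the channel with Choi operator `X`, and lets this channel supply the last input. -/
def feed {N : ℕ} {I O : Fin (N + 1) → Type} {A B : Type} [∀ j, DecidableEq (O j)]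
    (X : Op (((∀ j, I j) × A) × (O (Fin.last N) × B))) :
    Op (InnerIdx I O ((∀ j : Fin N, O j.castSucc) × A) B) :=
  Matrix.of fun r s =>
    if r.2.1 = r.1.1.2.1 ∧ s.2.1 = s.1.1.2.1 then
      X ((Fin.cons r.1.1.1 r.1.2, r.1.1.2.2), r.2.2) ((Fin.cons s.1.1.1 s.1.2, s.1.1.2.2), s.2.2)
    else 0

lemma feed_posSemidef {N : ℕ} {I O : Fin (N + 1) → Type} {A B : Type} [∀ j, DecidableEq (O j)]
    {X : Op (((∀ j, I j) × A) × (O (Fin.last N) × B))} (hX : X.PosSemidef) :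
    (feed X).PosSemidef := by
  have h := (hX.submatrix (fun r : InnerIdx I O ((∀ j : Fin N, O j.castSucc) × A) B =>
    (((Fin.cons r.1.1.1 r.1.2 : ∀ j, I j), r.1.1.2.2), r.2.2))).hadamard
    (posSemidef_vec_mul_star
      fun r : InnerIdx I O ((∀ j : Fin N, O j.castSucc) × A) B =>
        if r.2.1 = r.1.1.2.1 then (1 : ℂ) else 0)
  refine (congrArg Matrix.PosSemidef ?_).mp h
  ext r s
  simp only [feed, Matrix.of_apply, Matrix.hadamard_apply, Matrix.submatrix_apply, apply_ite star,
    star_one, star_zero, mul_ite, mul_one, mul_zero, ite_and]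
  split_ifs <;> rfl

/-- An instance of `sequential_of_delta`: normalization of `X` produces deltas in all `I j` and in
`A`. Those in `I j.succ` are the discarded outputs; those in `I 0` and `A` form `K`. -/
lemma sequential_feed {N : ℕ} {I O : Fin (N + 1) → Type} {A B : Type} [∀ j, DecidableEq (O j)]
    [∀ j, Fintype (O j)] [∀ j, DecidableEq (I j)] [Fintype B] [DecidableEq A]
    {X : Op (((∀ j, I j) × A) × (O (Fin.last N) × B))}
    (hX : ∀ i i', ∑ y, X (i, y) (i', y) = if i = i' then 1 else 0) :
    Sequential N (I 0 × ((∀ j : Fin N, O j.castSucc) × A)) (fun j : Fin N => O j.castSucc)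
      (fun j : Fin N => I j.succ) (traceFuture (feed X)) := by
  have h := sequential_of_delta N (I 0 × ((∀ j : Fin N, O j.castSucc) × A))
    (fun j : Fin N => O j.castSucc) (fun j : Fin N => I j.succ) (fun j q => q.2.1 j)
    (Matrix.of fun q q' => if q.1 = q'.1 ∧ q.2.2 = q'.2.2 then 1 else 0) ?_
  · convert h using 1
    ext r s
    simp only [traceFuture, feed, Matrix.of_apply, Finset.sum_ite_irrel, Finset.sum_const_zero, hX,
      ← ite_and]
    refine if_congr ?_ rfl rfl
    rw [Prod.mk.injEq, Fin.cons_inj]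
    simp only [funext_iff]
    tauto
  · rintro ⟨q1, q2, q3⟩ ⟨q1', q2', q3'⟩
    simp only [Matrix.of_apply, ← ite_and, Prod.mk.injEq, funext_iff]
    refine if_congr ?_ rfl rfl
    tauto

/-- The wires merely relabel systems, so only the contraction with `X` over all `I j` and the last
`O` remains. -/
lemma insertComb_feed {N : ℕ} {P F : Type} {I O : Fin (N + 1) → Type} {A B : Type}
    [∀ j, Fintype (I j)] [∀ j, Fintype (O j)] [∀ j, DecidableEq (O j)]
    (R : Op (CombIdx P F I O))
    (X : Op (((∀ j, I j) × A) × (O (Fin.last N) × B))) (p p' : P)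
    (u u' : ∀ j : Fin N, O j.castSucc) (a a' : A) (f f' : F) (b b' : B) :
    insertComb R (feed X) ((p, (u, a)), (f, b)) ((p', (u', a')), (f', b')) =
      ∑ i, ∑ i', ∑ o, ∑ o', R ((p, Fin.snoc u o), (i, f)) ((p', Fin.snoc u' o'), (i', f')) *
        X ((i, a), (o, b)) ((i', a'), (o', b')) := by
  simp only [insertComb, link, Matrix.submatrix_apply, Matrix.of_apply, Fintype.sum_prod_type]
  refine Finset.sum_congr rfl fun i _ => ?_
  rw [Finset.sum_comm]
  refine Finset.sum_congr rfl fun i' _ => ?_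
  have e : ∀ o o' : ∀ j, O j, outerInner R ((p, f), (i, o)) ((p', f'), (i', o')) *
      innerOuter (feed X) ((i, o), ((u, a), b)) ((i', o'), ((u', a'), b')) =
      if (fun j : Fin N => o j.castSucc) = u then
        if (fun j : Fin N => o' j.castSucc) = u' then
        R ((p, o), (i, f)) ((p', o'), (i', f')) *
          X ((i, a), (o (Fin.last N), b)) ((i', a'), (o' (Fin.last N), b')) else 0 else 0 := by
    intro o o'
    have hi : ∀ i : ∀ j, I j, (Fin.cons (i 0) fun j => i j.succ : ∀ j, I j) = i :=
      fun i => Fin.cons_self_tail i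
    simp only [outerInner, innerOuter, feed, Matrix.submatrix_apply, Matrix.of_apply, hi, ite_and,
      mul_ite, mul_zero]
  simp only [e, sum_snoc (α := O), Fin.snoc_castSucc, Fin.snoc_last]
  rw [Finset.sum_eq_single u]
  · refine Finset.sum_congr rfl fun o _ => ?_
    rw [Finset.sum_eq_single u']
    · simp
    · intro v _ hv
      simp [hv]
    · simp
  · intro v _ hv
    simp [hv]
  · simp

/-- An inserted comb that discards the output of the last slot and prepares its input in the basis
state `o₀`. -/
def extend {M : ℕ} {I O : Fin (M + 2) → Type} {A B : Type} [∀ j, DecidableEq (I j)]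
    [∀ j, DecidableEq (O j)] (o₀ : O (Fin.last (M + 1)))
    (S : Op (InnerIdx (fun j : Fin (M + 1) => I j.castSucc) (fun j : Fin (M + 1) => O j.castSucc)
      A B)) : Op (InnerIdx I O A B) :=
  Matrix.of fun r s =>
    S ((r.1.1, fun j => r.1.2 j.castSucc),
        (fun j => r.2.1 j.castSucc, (r.2.1 (Fin.last M), r.2.2.2)))
      ((s.1.1, fun j => s.1.2 j.castSucc),
        (fun j => s.2.1 j.castSucc, (s.2.1 (Fin.last M), s.2.2.2))) *
    ((if r.1.2 (Fin.last M) = s.1.2 (Fin.last M) then 1 else 0) *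
      ((if r.2.2.1 = o₀ then 1 else 0) * star (if s.2.2.1 = o₀ then (1 : ℂ) else 0)))

lemma extend_posSemidef {M : ℕ} {I O : Fin (M + 2) → Type} {A B : Type} [∀ j, DecidableEq (I j)]
    [∀ j, DecidableEq (O j)] (o₀ : O (Fin.last (M + 1)))
    {S : Op (InnerIdx (fun j : Fin (M + 1) => I j.castSucc) (fun j : Fin (M + 1) => O j.castSucc)
      A B)} (hS : S.PosSemidef) : (extend (I := I) (O := O) o₀ S).PosSemidef :=
  (hS.submatrix _).hadamard (((Matrix.PosSemidef.one
    (n := I (Fin.last M).succ) (R := ℂ)).submatrix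
      (fun r : InnerIdx I O A B => r.1.2 (Fin.last M))).hadamard
    (posSemidef_vec_mul_star fun r : InnerIdx I O A B => if r.2.2.1 = o₀ then (1 : ℂ) else 0))

lemma sum_extend {M : ℕ} {I O : Fin (M + 2) → Type} {A B : Type} [∀ j, DecidableEq (I j)]
    [∀ j, DecidableEq (O j)] [Fintype B] (o₀ : O (Fin.last (M + 1)))
    (S : Op (InnerIdx (fun j : Fin (M + 1) => I j.castSucc) (fun j : Fin (M + 1) => O j.castSucc)
      A B)) (r s) (o o' : O (Fin.last (M + 1))) (x x') :
    ∑ b, extend (I := I) (O := O) o₀ S (r, (x, (o, b))) (s, (x', (o', b))) =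
      if r.2 (Fin.last M) = s.2 (Fin.last M) ∧ o = o₀ ∧ o' = o₀ then
        ∑ b, S ((r.1, fun j => r.2 j.castSucc), (fun j => x j.castSucc, (x (Fin.last M), b)))
          ((s.1, fun j => s.2 j.castSucc), (fun j => x' j.castSucc, (x' (Fin.last M), b)))
      else 0 := by
  simp only [extend, Matrix.of_apply, ite_and]
  split_ifs <;> simp_all

/-- Discarding the last `I` system gives the delta of the top level, and `o₀` contributes trace one.
The operator below is `S` with only `B` traced out; tracing its last `O` system completes
`traceFuture S`. -/
lemma sequential_extend {M : ℕ} {I O : Fin (M + 2) → Type} {A B : Type} [∀ j, DecidableEq (I j)]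
    [∀ j, DecidableEq (O j)] [∀ j, Fintype (O j)] [Fintype B] [DecidableEq A]
    (o₀ : O (Fin.last (M + 1)))
    {S : Op (InnerIdx (fun j : Fin (M + 1) => I j.castSucc) (fun j : Fin (M + 1) => O j.castSucc)
      A B)} (hS : Sequential M (I 0 × A) (fun j : Fin M => O j.castSucc.castSucc)
        (fun j : Fin M => I j.succ.castSucc) (traceFuture S)) :
    Sequential (M + 1) (I 0 × A) (fun j : Fin (M + 1) => O j.castSucc)
      (fun j : Fin (M + 1) => I j.succ) (traceFuture (extend (I := I) (O := O) o₀ S)) := by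
  refine ⟨Matrix.of fun r s =>
    ∑ b, S (r.1, (fun j => r.2 j.castSucc, (r.2 (Fin.last M), b)))
          (s.1, (fun j => s.2 j.castSucc, (s.2 (Fin.last M), b))), ?_, ?_⟩
  · intro p o i p' o' i'
    simp only [traceFuture, Matrix.of_apply, Fintype.sum_prod_type, sum_extend]
    rw [Finset.sum_eq_single o₀]
    · simp
    · intro b _ hb
      simp [hb]
    · simp
  · refine (congrArg (Sequential M (I 0 × A) _ _) ?_).mp hS
    ext r s
    simp only [traceFuture, Matrix.of_apply, Fintype.sum_prod_type, Fin.snoc_castSucc,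
      Fin.snoc_last]
    rfl

/-- A positive operator that sends the inserted combs `feed X` to channels satisfies the first
causality condition. -/
lemma traceFuture_eq_of_feed {N : ℕ} {P F : Type} {I O : Fin (N + 1) → Type}
    [DecidableEq P] [Fintype F] [∀ j, Fintype (I j)] [∀ j, DecidableEq (I j)]
    [∀ j, Fintype (O j)] [∀ j, DecidableEq (O j)] (R : Op (CombIdx P F I O)) (o₀ : O (Fin.last N))
    (h : ∀ X : Op (((∀ j, I j) × Unit) × (O (Fin.last N) × Unit)), X.PosSemidef →
      (∀ i i', ∑ y, X (i, y) (i', y) = if i = i' then 1 else 0) → ∀ x x',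
      ∑ y, insertComb R (feed X) (x, y) (x', y) = if x = x' then 1 else 0)
    (p p' : P) (u u' : ∀ j : Fin N, O j.castSucc) :
    (∀ i o i' o', traceFuture R ((p, Fin.snoc u o), i) ((p', Fin.snoc u' o'), i') =
      if o = o' then
        traceFuture R ((p, Fin.snoc u o₀), i) ((p', Fin.snoc u' o₀), i') else 0) ∧
    ∑ i, traceFuture R ((p, Fin.snoc u o₀), i) ((p', Fin.snoc u' o₀), i) =
      if p = p' ∧ u = u' then 1 else 0 := by
  have := eq_of_constant_on_channels (x := (∀ j, I j) × Unit) (y := O (Fin.last N) × Unit)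
    (fun r s => traceFuture R ((p, Fin.snoc u r.2.1), r.1.1) ((p', Fin.snoc u' s.2.1), s.1.1))
    (if p = p' ∧ u = u' then 1 else 0) (o₀, ()) ?_
  · refine ⟨fun i o i' o' => ?_, ?_⟩
    · simpa using this.1 (i, ()) (o, ()) (i', ()) (o', ())
    · simpa [Fintype.sum_prod_type] using this.2
  · intro X hX hX1
    have h1 := h X hX hX1 (p, (u, ())) (p', (u', ()))
    simp only [Prod.mk.injEq, and_true] at h1
    rw [← h1]
    simp only [Fintype.sum_prod_type, insertComb_feed, traceFuture, Matrix.of_apply,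
      Finset.univ_unique, Finset.sum_singleton, PUnit.default_eq_unit, Finset.sum_mul]
    symm
    rw [Finset.sum_comm]
    refine Finset.sum_congr rfl fun i _ => ?_
    rw [Finset.sum_comm, Finset.sum_comm (s := (Finset.univ : Finset (O (Fin.last N))))]
    refine Finset.sum_congr rfl fun i' _ => ?_
    rw [Finset.sum_comm]
    refine Finset.sum_congr rfl fun o _ => ?_
    rw [Finset.sum_comm]

/-- Combs with `N` slots are the positive operators with causal normalization. -/
def CombIffSequential (N : ℕ) : Prop :=
  ∀ (P F : Type) (I O : Fin N → Type)
    [Fintype P] [DecidableEq P] [Fintype F] [Nonempty P] [Nonempty F]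
    [∀ j, Fintype (I j)] [∀ j, DecidableEq (I j)] [∀ j, Nonempty (I j)]
    [∀ j, Fintype (O j)] [∀ j, DecidableEq (O j)] [∀ j, Nonempty (O j)]
    (R : Op (CombIdx P F I O)),
    IsComb N P F I O R ↔ R.PosSemidef ∧ Sequential N P I O (traceFuture R)

lemma combIffSequential_zero : CombIffSequential 0 := by
  intro P F I O _ _ _ _ _ _ _ _ _ _ _ R
  have hr : ∀ r : CombIdx P F I O,
      r = ((r.1.1, fun j => j.elim0), (fun j => j.elim0, r.2.2)) := fun r =>
    Prod.ext (Prod.ext rfl (Subsingleton.elim _ _)) (Prod.ext (Subsingleton.elim _ _) rfl)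
  refine (exists_channel_iff _).trans (and_congr ⟨fun h => ?_, fun h => h.submatrix _⟩ ?_)
  · convert h.submatrix (fun r : CombIdx P F I O => (r.1.1, r.2.2)) using 1
    ext r s
    rw [Matrix.submatrix_apply, Matrix.submatrix_apply]
    exact congrArg₂ R (hr r) (hr s)
  · have : ∀ r s, traceFuture R r s = ∑ y, R ((r.1.1, fun j => j.elim0), (fun j => j.elim0, y))
        ((s.1.1, fun j => j.elim0), (fun j => j.elim0, y)) := by
      intro r s
      simp only [traceFuture, Matrix.of_apply]
      refine Finset.sum_congr rfl fun y _ => ?_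
      exact congrArg₂ R (hr (r.1, (r.2, y))) (hr (s.1, (s.2, y)))
    constructor
    · intro h r s
      rw [this]
      exact h _ _
    · intro h x x'
      have h1 := h ((x, fun j => j.elim0), fun j => j.elim0)
        ((x', fun j => j.elim0), fun j => j.elim0)
      rw [this] at h1
      exact h1

/-- Choi's theorem and the characterization one level down turn the recursive definition into a
statement about matrices only. -/
lemma isComb_succ_iff {N : ℕ} (ih : CombIffSequential N) (P F : Type) (I O : Fin (N + 1) → Type)
    [Fintype P] [DecidableEq P] [Fintype F] [Nonempty P] [Nonempty F]
    [∀ j, Fintype (I j)] [∀ j, DecidableEq (I j)] [∀ j, Nonempty (I j)]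
    [∀ j, Fintype (O j)] [∀ j, DecidableEq (O j)] [∀ j, Nonempty (O j)]
    (R : Op (CombIdx P F I O)) :
    IsComb (N + 1) P F I O R ↔
      ∀ (A B : Type) [Fintype A] [DecidableEq A] [Nonempty A]
        [Fintype B] [DecidableEq B] [Nonempty B] (S : Op (InnerIdx I O A B)),
        S.PosSemidef → Sequential N (I 0 × A) (fun j : Fin N => O j.castSucc)
          (fun j : Fin N => I j.succ) (traceFuture S) →
        (insertComb R S).PosSemidef ∧
        ∀ x x', ∑ y, insertComb R S (x, y) (x', y) = if x = x' then 1 else 0 := by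
  constructor
  · intro h A B _ _ _ _ _ _ S hS1 hS2
    exact (exists_channel_iff _).1 (h A B S ((ih _ _ _ _ S).2 ⟨hS1, hS2⟩))
  · intro h A B _ _ _ _ _ _ S hS
    exact (exists_channel_iff _).2 (h A B S ((ih _ _ _ _ S).1 hS).1 ((ih _ _ _ _ S).1 hS).2)

/-- Inserting `extend o₀ S` fixes the last `O` system of `R` at `o₀` and traces out its last `I`
system, which is the future of `R'`. Normalization thus passes from `R` to the smaller operator
`R'`. -/
lemma sum_insertComb_extend {M : ℕ} {P F : Type} {I O : Fin (M + 2) → Type} {A B : Type}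
    [∀ j, Fintype (I j)] [∀ j, DecidableEq (I j)] [∀ j, Fintype (O j)] [∀ j, DecidableEq (O j)]
    [Fintype F] [Fintype B] (R : Op (CombIdx P F I O)) (o₀ : O (Fin.last (M + 1)))
    (R' : Op (CombIdx P (I (Fin.last (M + 1))) (fun j : Fin (M + 1) => I j.castSucc)
      (fun j : Fin (M + 1) => O j.castSucc)))
    (hR' : ∀ p u i x p' u' i' x', R' ((p, u), (i, x)) ((p', u'), (i', x')) =
      traceFuture R ((p, Fin.snoc u o₀), Fin.snoc i x) ((p', Fin.snoc u' o₀), Fin.snoc i' x'))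
    (S : Op (InnerIdx (fun j : Fin (M + 1) => I j.castSucc) (fun j : Fin (M + 1) => O j.castSucc)
      A B)) (x x' : P × A) :
    ∑ y, insertComb R (extend (I := I) (O := O) o₀ S) (x, y) (x', y) =
      ∑ y, insertComb R' S (x, y) (x', y) := by
  obtain ⟨p, a⟩ := x
  obtain ⟨p', a'⟩ := x'
  rw [traceFuture_insertComb, traceFuture_insertComb]
  simp only [sum_extend, sum_snoc (α := I)]
  refine Finset.sum_congr rfl fun f _ => ?_
  rw [Finset.sum_comm]
  refine Finset.sum_congr rfl fun f' _ => ?_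
  have h0 : ∀ f x, (Fin.snoc f x : ∀ j, I j) 0 = f 0 :=
    fun f x => Fin.snoc_castSucc (α := I) x f 0
  have hs : ∀ f x (j : Fin M), (Fin.snoc f x : ∀ j, I j) j.castSucc.succ = f j.succ :=
    fun f x j => Fin.snoc_castSucc (α := I) x f j.succ
  have hl : ∀ f x, (Fin.snoc f x : ∀ j, I j) (Fin.last M).succ = x :=
    fun f x => Fin.snoc_last (α := I) x f
  simp only [h0, hs, hl, sum_snoc (α := O), Fin.snoc_last, Fin.snoc_castSucc, ite_and, mul_ite,
    mul_zero, Finset.sum_ite_irrel, Finset.sum_const_zero, Finset.sum_ite_eq,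
    Finset.sum_ite_eq', Finset.mem_univ, if_true]
  rw [Finset.sum_comm]
  refine Finset.sum_congr rfl fun u _ => ?_
  rw [Finset.sum_comm]
  refine Finset.sum_congr rfl fun u' _ => ?_
  simp only [traceFuture, Matrix.of_apply, hR']
  exact (Finset.sum_mul _ _ _).symm

/-- Quantum combs are the positive operators with causal normalization. -/
theorem combIffSequential (N : ℕ) : CombIffSequential N := by
  induction N using Nat.strong_induction_on with
  | _ n ih =>
  cases n with
  | zero => exact combIffSequential_zero
  | succ N =>
    intro P F I O _ _ _ _ _ _ _ _ _ _ _ R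
    rw [isComb_succ_iff (ih N (Nat.lt_succ_self N))]
    constructor
    · intro h
      have hpos : R.PosSemidef := by
        -- Feeding in the identity channel, up to a swap of factors, routes all slot systems to the
        -- outside. The result is `R` itself with its indices permuted.
        have h1 := (h ((∀ j : Fin N, O j.castSucc) × O (Fin.last N)) (∀ j, I j)
          (feed (Matrix.of fun r s =>
            (if r.1.1 = r.2.2 ∧ r.1.2 = r.2.1 then 1 else 0) *
              star (if s.1.1 = s.2.2 ∧ s.1.2 = s.2.1 then (1 : ℂ) else 0)))
          (feed_posSemidef (posSemidef_vec_mul_star _)) (sequential_feed ?_)).1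
        · have h2 := h1.submatrix fun r : CombIdx P F I O =>
            ((r.1.1, ((fun j => r.1.2 j.castSucc), r.1.2 (Fin.last N))), (r.2.2, r.2.1))
          refine (congrArg Matrix.PosSemidef ?_).mp h2
          ext ⟨⟨p, o⟩, ⟨i, f⟩⟩ ⟨⟨p', o'⟩, ⟨i', f'⟩⟩
          have hs : ∀ o : ∀ j, O j,
            (Fin.snoc (fun j : Fin N => o j.castSucc) (o (Fin.last N)) : ∀ j, O j) = o :=
            fun o => Fin.snoc_init_self o
          simp only [Matrix.submatrix_apply, insertComb_feed, Matrix.of_apply]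
          rw [Finset.sum_eq_single i, Finset.sum_eq_single i', Finset.sum_eq_single (o (Fin.last N)),
            Finset.sum_eq_single (o' (Fin.last N))]
          · simp [hs]
          all_goals first | simp; done | (intro b _ hb; simp [hb, hb.symm])
        · rintro ⟨i, o⟩ ⟨i', o'⟩
          simp only [Matrix.of_apply, Fintype.sum_prod_type, Prod.mk.injEq]
          rw [Finset.sum_eq_single o, Finset.sum_eq_single i]
          · simp only [and_self, if_true, one_mul, apply_ite star, star_one, star_zero]
            refine if_congr ?_ rfl rfl
            tauto
          all_goals first | simp; done | (intro b _ hb; simp [hb.symm])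
      refine ⟨hpos, ?_⟩
      obtain ⟨o₀⟩ : Nonempty (O (Fin.last N)) := inferInstance
      have key := traceFuture_eq_of_feed R o₀ fun X hX hX1 =>
        (h _ Unit (feed X) (feed_posSemidef hX) (sequential_feed hX1)).2
      have hs : ∀ o : ∀ j, O j,
        (Fin.snoc (fun j : Fin N => o j.castSucc) (o (Fin.last N)) : ∀ j, O j) = o :=
        fun o => Fin.snoc_init_self o
      have hT : ∀ p o i p' o' i', traceFuture R ((p, o), i) ((p', o'), i') =
          if o (Fin.last N) = o' (Fin.last N) then
            traceFuture R ((p, Fin.snoc (fun j => o j.castSucc) o₀), i)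
              ((p', Fin.snoc (fun j => o' j.castSucc) o₀), i') else 0 := by
        intro p o i p' o' i'
        rw [← (key p p' _ _).1, hs, hs]
      refine ⟨(traceFuture R).submatrix (fun r => ((r.1.1, Fin.snoc r.1.2 o₀), r.2))
        (fun r => ((r.1.1, Fin.snoc r.1.2 o₀), r.2)), hT, ?_⟩
      -- After removal of the last `O` system, the last `I` system becomes the future of an operator
      -- with `N` slots.
      set R' : Op (CombIdx P (I (Fin.last N)) (fun j : Fin N => I j.castSucc)
        (fun j : Fin N => O j.castSucc)) := (traceFuture R).submatrix
          (fun r => ((r.1.1, Fin.snoc r.1.2 o₀), Fin.snoc r.2.1 r.2.2))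
          (fun r => ((r.1.1, Fin.snoc r.1.2 o₀), Fin.snoc r.2.1 r.2.2)) with hR'
      have hTpos : (traceFuture R).PosSemidef :=
        posSemidef_sum_diag _ (hpos.submatrix
          fun r : ((P × ∀ j, O j) × ∀ j, I j) × F => (r.1.1, (r.1.2, r.2)))
      have hR'pos : R'.PosSemidef := hTpos.submatrix _
      change Sequential N P _ _ (traceFuture R')
      cases N with
      | zero =>
        rintro ⟨⟨p, o⟩, i⟩ ⟨⟨p', o'⟩, i'⟩
        have h1 := (key p p' o o').2
        rw [sum_snoc] at h1
        simp only [Fintype.sum_unique] at h1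
        simp only [traceFuture, hR', Matrix.of_apply, Matrix.submatrix_apply] at h1 ⊢
        rw [Subsingleton.elim i default, Subsingleton.elim i' default, h1]
        refine if_congr ?_ rfl rfl
        simp [Subsingleton.elim o o']
      | succ M =>
        -- `R'` is tested against combs with `M` slots, so the characterization is needed two levels
        -- down as well as one; hence the strong induction.
        refine ((ih (M + 1) (Nat.lt_succ_self _) P (I (Fin.last (M + 1)))
          (fun j => I j.castSucc) (fun j => O j.castSucc) R').1 ?_).2
        refine (isComb_succ_iff (ih M (by omega)) _ _ _ _ _).2 ?_
        intro A B _ _ _ _ _ _ S hS1 hS2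
        refine ⟨insertComb_posSemidef hR'pos hS1, fun x x' => ?_⟩
        rw [← sum_insertComb_extend R o₀ R' (fun _ _ _ _ _ _ _ _ => rfl) S x x']
        exact (h A B _ (extend_posSemidef o₀ hS1) (sequential_extend o₀ hS2)).2 x x'
    · rintro ⟨hpos, R', hR', hseq⟩ A B _ _ _ _ _ _ S hS1 hS2
      refine ⟨insertComb_posSemidef hpos hS1, ?_⟩
      rintro ⟨p, a⟩ ⟨p', a'⟩
      rw [traceFuture_insertComb, if_congr Prod.mk_inj rfl rfl,
        ← sum_mul_of_sequential N P A I (fun j => O j.castSucc) R' _ hseq hS2 p p' a a']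
      refine Finset.sum_congr rfl fun i _ => Finset.sum_congr rfl fun i' _ => ?_
      simp only [hR', sum_snoc (α := O), Fin.snoc_last, Fin.snoc_castSucc, ite_mul, zero_mul]
      refine Finset.sum_congr rfl fun u _ => ?_
      rw [Finset.sum_comm]
      refine Finset.sum_congr rfl fun u' _ => ?_
      simp only [Finset.sum_ite_eq, Finset.mem_univ, if_true, traceFuture, Matrix.of_apply,
        Fintype.sum_prod_type]
      exact (Finset.mul_sum _ _ _).symm

/-! ### Minimal purifications -/

/-- A positive operator is the partial trace of a purification with injective memory. -/
lemma exists_purification {z : Type} [Fintype z] [DecidableEq z] {W : Op z} (hW : W.PosSemidef) :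
    ∃ (k : ℕ) (X : Matrix z (Fin k) ℂ) (L : Matrix (Fin k) z ℂ), W = X * Xᴴ ∧ L * X = 1 := by
  set E : Matrix z z ℂ := (hW.1.eigenvectorUnitary : Matrix z z ℂ) with hE
  set l := hW.1.eigenvalues with hl
  have hE1 : Eᴴ * E = 1 := Unitary.coe_star_mul_self hW.1.eigenvectorUnitary
  have hspec : W = E * Matrix.diagonal (fun i => (l i : ℂ)) * Eᴴ := hW.1.spectral_theorem
  have hpos : ∀ i, 0 ≤ l i := hW.eigenvalues_nonneg
  let e := Fintype.equivFin {i // l i ≠ 0}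
  -- Keeping only nonzero eigenvalues makes the memory dimension equal to the rank and allows `L` to
  -- divide by their square roots.
  refine ⟨Fintype.card {i // l i ≠ 0},
    Matrix.of fun r j => E r (e.symm j) * (Real.sqrt (l (e.symm j)) : ℂ),
    Matrix.of fun j r => star (E r (e.symm j)) * ((Real.sqrt (l (e.symm j)) : ℂ))⁻¹, ?_, ?_⟩
  · ext r s
    have h1 : ∀ i, E r i * (l i : ℂ) * star (E s i) =
        (E r i * (Real.sqrt (l i) : ℂ)) * star (E s i * (Real.sqrt (l i) : ℂ)) := by
      intro i
      have : (l i : ℂ) = (Real.sqrt (l i) : ℂ) * (Real.sqrt (l i) : ℂ) := by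
        rw [← Complex.ofReal_mul, Real.mul_self_sqrt (hpos i)]
      rw [this, star_mul', Complex.star_def, Complex.conj_ofReal]
      ring
    have h2 : W r s = ∑ i, E r i * (l i : ℂ) * star (E s i) := by
      conv_lhs => rw [hspec]
      simp [Matrix.mul_apply, Matrix.diagonal_apply]
    rw [h2, Matrix.mul_apply, ← e.sum_comp]
    simp only [Matrix.of_apply, Matrix.conjTranspose_apply, Equiv.symm_apply_apply, ← h1]
    have h3 : ∀ i, l i ≠ 0 ∨ E r i * (l i : ℂ) * star (E s i) = 0 := by
      intro i
      by_cases h : l i = 0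
      · exact Or.inr (by simp [h])
      · exact Or.inl h
    rw [← Finset.sum_subtype (Finset.univ.filter fun i => l i ≠ 0) (by simp)
      fun i => E r i * (l i : ℂ) * star (E s i)]
    symm
    refine Finset.sum_subset (Finset.subset_univ _) fun i _ hi => ?_
    exact (h3 i).resolve_left (by simpa using hi)
  · ext j j'
    have h3 := congrFun (congrFun hE1 (e.symm j)) (e.symm j')
    have hj : (Real.sqrt (l (e.symm j)) : ℂ) ≠ 0 := by
      rw [Complex.ofReal_ne_zero]
      exact (Real.sqrt_pos.2 ((hpos _).lt_of_ne' (e.symm j).2)).ne'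
    have h4 : (∑ r, star (E r (e.symm j)) * E r (e.symm j')) = if j = j' then 1 else 0 := by
      simpa [Matrix.mul_apply, Matrix.one_apply, Subtype.coe_inj] using h3
    have h5 : ∀ r, star (E r (e.symm j)) * ((Real.sqrt (l (e.symm j)) : ℂ))⁻¹ *
        (E r (e.symm j') * (Real.sqrt (l (e.symm j')) : ℂ)) =
        star (E r (e.symm j)) * E r (e.symm j') *
          (((Real.sqrt (l (e.symm j)) : ℂ))⁻¹ * (Real.sqrt (l (e.symm j')) : ℂ)) := by
      intro r; ring
    simp only [Matrix.mul_apply, Matrix.of_apply, h5, ← Finset.sum_mul, h4, Matrix.one_apply]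
    by_cases h : j = j'
    · subst h
      simp [hj]
    · simp [h]

/-- Two purifications of the same operator, one of them with injective memory, are related by
a co-isometry. -/
lemma exists_coisometry {r a b : Type} [Fintype r] [Fintype a] [DecidableEq a] [Fintype b]
    {Y : Matrix r b ℂ} {Z : Matrix r a ℂ} {L : Matrix a r ℂ} (h : Y * Yᴴ = Z * Zᴴ)
    (hL : L * Z = 1) : ∃ V : Matrix a b ℂ, V * Vᴴ = 1 ∧ Z * V = Y := by
  refine ⟨L * Y, ?_, ?_⟩
  · rw [Matrix.conjTranspose_mul, Matrix.mul_assoc, ← Matrix.mul_assoc Y, h, Matrix.mul_assoc Z,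
      ← Matrix.mul_assoc, hL, Matrix.one_mul, ← Matrix.conjTranspose_mul, hL,
      Matrix.conjTranspose_one]
  · rw [← sub_eq_zero, ← Matrix.self_mul_conjTranspose_eq_zero]
    have hL' : Zᴴ * Lᴴ = 1 := by rw [← Matrix.conjTranspose_mul, hL, Matrix.conjTranspose_one]
    have e1 : Z * (L * Y) * Yᴴ = Z * Zᴴ := by
      rw [Matrix.mul_assoc, Matrix.mul_assoc, h, ← Matrix.mul_assoc L, hL, Matrix.one_mul]
    have e2 : Y * (Z * (L * Y))ᴴ = Z * Zᴴ := by
      rw [← Matrix.conjTranspose_conjTranspose Y, ← Matrix.conjTranspose_mul,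
        Matrix.conjTranspose_conjTranspose, e1, Matrix.conjTranspose_mul,
        Matrix.conjTranspose_conjTranspose]
    have e3 : Z * (L * Y) * (Z * (L * Y))ᴴ = Z * Zᴴ := by
      rw [Matrix.mul_assoc, Matrix.mul_assoc, e2, ← Matrix.mul_assoc L, hL, Matrix.one_mul]
    rw [Matrix.conjTranspose_sub, Matrix.mul_sub, Matrix.sub_mul, Matrix.sub_mul, e1, e2, e3, h]
    simp

/-! ### The sequence of reduced operators -/

/-- Basis labels of the first `n` inputs and the first `n` outputs. -/
abbrev InitIdx (H : ℕ → Type) (n : ℕ) : Type :=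
  (∀ i : Fin n, H (2 * i)) × (∀ i : Fin n, H (2 * i + 1))

/-- The regrouping of the first `n + 1` inputs as past and slot outputs. -/
def splitFirst {H : ℕ → Type} {n : ℕ} (r : InitIdx H (n + 1)) :
    (H 0 × ∀ j : Fin n, H (2 * j + 2)) × ∀ j : Fin (n + 1), H (2 * j + 1) :=
  ((r.1 0, fun j => r.1 j.succ), r.2)

/-- Unwinds `Sequential` into a single family of operators, with past and slot outputs merged into
one list of inputs. -/
lemma exists_reductions {H : ℕ → Type} [∀ m, Fintype (H m)] [∀ m, DecidableEq (H m)]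
    [∀ m, Nonempty (H m)] (N : ℕ) :
    ∀ (R : Op ((H 0 × ∀ j : Fin N, H (2 * j + 2)) × ∀ j : Fin (N + 1), H (2 * j + 1)))
      (_ : R.PosSemidef) (_ : Sequential N (H 0) (fun j : Fin N => H (2 * j + 1))
        (fun j : Fin N => H (2 * j + 2))
        (Matrix.of fun r s => ∑ x : H (2 * N + 1),
          R (r.1, Fin.snoc (α := fun j : Fin (N + 1) => H (2 * j + 1)) r.2 x)
            (s.1, Fin.snoc (α := fun j : Fin (N + 1) => H (2 * j + 1)) s.2 x))),
    ∃ W : ∀ n, Op (InitIdx H n), (∀ n, (W n).PosSemidef) ∧ W 0 = 1 ∧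
      (∀ n ≤ N, ∀ (x x' : ∀ i : Fin (n + 1), H (2 * i)) (y y' : ∀ i : Fin n, H (2 * i + 1)),
        ∑ z : H (2 * n + 1), W (n + 1)
          (x, Fin.snoc (α := fun j : Fin (n + 1) => H (2 * j + 1)) y z)
          (x', Fin.snoc (α := fun j : Fin (n + 1) => H (2 * j + 1)) y' z) =
        if x (Fin.last n) = x' (Fin.last n) then
          W n (fun i => x i.castSucc, y) (fun i => x' i.castSucc, y') else 0) ∧
      W (N + 1) = R.submatrix splitFirst splitFirst := by
  induction N with
  | zero =>
    intro R hR hseq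
    -- At level 0 the index type is a singleton, so 1 is the required operator; the values above
    -- level 1 are arbitrary positive fillers.
    refine ⟨Function.update (fun _ => 1) 1 (R.submatrix splitFirst splitFirst), ?_, ?_, ?_, ?_⟩
    · intro n
      rcases eq_or_ne n 1 with rfl | hn
      · simpa using hR.submatrix splitFirst
      · simpa [hn] using Matrix.PosSemidef.one
    · simp
    · intro n hn x x' y y'
      obtain rfl : n = 0 := by omega
      simp only [Function.update_self]
      refine (hseq ((x 0, fun j => x j.succ), y) ((x' 0, fun j => x' j.succ), y')).trans ?_
      rw [Function.update_of_ne (by omega)]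
      refine if_congr Iff.rfl ?_ rfl
      have h1 : ∀ r s : InitIdx H 0, (1 : Op (InitIdx H 0)) r s = 1 := fun r s => by
        rw [Subsingleton.elim s r, Matrix.one_apply_eq]
      exact (h1 _ _).symm
    · simp
  | succ N ih =>
    intro R hR hseq
    obtain ⟨R', hR', hseq'⟩ := hseq
    obtain ⟨o₀⟩ : Nonempty (H (2 * (Fin.last N : Fin (N + 1)) + 2)) := inferInstance
    -- `R'` is a diagonal block of a partial trace of `R`: the last input is fixed at `o₀` on both
    -- sides.
    have hR'pos : R'.PosSemidef := by
      have h1 := posSemidef_sum_diag _ (hR.submatrix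
        fun r : ((H 0 × ∀ j : Fin (N + 1), H (2 * j + 2)) × ∀ j : Fin (N + 1), H (2 * j + 1)) ×
          H (2 * (N + 1) + 1) =>
            (r.1.1, Fin.snoc (α := fun j : Fin (N + 2) => H (2 * j + 1)) r.1.2 r.2))
      have h2 := h1.submatrix
        fun r : (H 0 × ∀ j : Fin N, H (2 * j + 2)) × ∀ j : Fin (N + 1), H (2 * j + 1) =>
          ((r.1.1, Fin.snoc (α := fun j : Fin (N + 1) => H (2 * j + 2)) r.1.2 o₀), r.2)
      refine (congrArg Matrix.PosSemidef ?_).mp h2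
      ext ⟨⟨p, o⟩, i⟩ ⟨⟨p', o'⟩, i'⟩
      refine (hR' _ _ _ _ _ _).trans ?_
      simp only [Fin.snoc_last, Fin.snoc_castSucc, if_true]
    obtain ⟨W, hW1, hW2, hW3, hW4⟩ := ih R' hR'pos hseq'
    refine ⟨Function.update W (N + 2) (R.submatrix splitFirst splitFirst), ?_, ?_, ?_, ?_⟩
    · intro n
      rcases eq_or_ne n (N + 2) with rfl | hn
      · simpa using hR.submatrix splitFirst
      · simpa [hn] using hW1 n
    · simpa using hW2
    · intro n hn x x' y y'
      rw [Function.update_of_ne (show n ≠ N + 2 by omega)]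
      rcases eq_or_ne n (N + 1) with rfl | hn'
      · rw [Function.update_self, hW4]
        exact hR' (x 0) (fun j => x j.succ) y (x' 0) (fun j => x' j.succ) y'
      · rw [Function.update_of_ne (show n + 1 ≠ N + 2 by omega)]
        exact hW3 n (by omega) x x' y y'
    · simp

/-! ### Circuits -/

lemma circuit_succ {H : ℕ → Type} [∀ m, Fintype (H m)] [∀ m, DecidableEq (H m)] {k : ℕ → ℕ}
    (V : ∀ n, Matrix (H (2 * n + 1) × Fin (k (n + 1))) (H (2 * n) × Fin (k n)) ℂ) (n : ℕ)
    (y : ∀ i : Fin (n + 1), H (2 * i + 1)) (a : Fin (k (n + 1))) (x : ∀ i : Fin (n + 1), H (2 * i)) :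
    circuit V (n + 1) (y, a) x =
      ∑ c, V n (y (Fin.last n), a) (x (Fin.last n), c) *
        circuit V n (fun i => y i.castSucc, c) (fun i => x i.castSucc) := by
  simp only [circuit, Matrix.submatrix_apply, Matrix.mul_apply, Fintype.sum_prod_type,
    Matrix.kroneckerMap_apply, id_eq]
  refine (Finset.sum_eq_single (fun i : Fin n => y i.castSucc) ?_ ?_).trans
    ((Finset.sum_eq_single (x (Fin.last n)) ?_ ?_).trans ?_)
  · intro b _ hb
    simp [Matrix.one_apply_ne hb.symm]
  · simp
  · intro b _ hb
    simp [Matrix.one_apply_ne hb]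
  · simp
  · simp

lemma card_le_of_isometry {a b : Type} [Fintype a] [Fintype b] [DecidableEq a]
    {V : Matrix b a ℂ} (hV : Vᴴ * V = 1) : Fintype.card a ≤ Fintype.card b := by
  have h1 := Matrix.rank_mul_le_left Vᴴ V
  rw [hV, Matrix.rank_one] at h1
  exact h1.trans (Matrix.rank_le_card_width _)

lemma card_eq_of_isUnitaryOp {a b : Type} [Fintype a] [Fintype b] [DecidableEq a] [DecidableEq b]
    {U : Matrix b a ℂ} (hU : IsUnitaryOp U) : Fintype.card a = Fintype.card b :=
  le_antisymm (card_le_of_isometry hU.1)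
    (card_le_of_isometry (V := Uᴴ) (by rw [Matrix.conjTranspose_conjTranspose]; exact hU.2))

/-- The isometry that relates the purifications of two consecutive reduced operators. -/
lemma exists_step {H : ℕ → Type} [∀ m, Fintype (H m)] [∀ m, DecidableEq (H m)] {n k k' : ℕ}
    {W : Op (InitIdx H n)} {W' : Op (InitIdx H (n + 1))}
    (hW : ∀ (x x' : ∀ i : Fin (n + 1), H (2 * i)) (y y' : ∀ i : Fin n, H (2 * i + 1)),
        ∑ z : H (2 * n + 1), W'
          (x, Fin.snoc (α := fun j : Fin (n + 1) => H (2 * j + 1)) y z)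
          (x', Fin.snoc (α := fun j : Fin (n + 1) => H (2 * j + 1)) y' z) =
        if x (Fin.last n) = x' (Fin.last n) then
          W (fun i => x i.castSucc, y) (fun i => x' i.castSucc, y') else 0)
    {X : Matrix (InitIdx H n) (Fin k) ℂ} {L : Matrix (Fin k) (InitIdx H n) ℂ}
    {X' : Matrix (InitIdx H (n + 1)) (Fin k') ℂ} (hX : W = X * Xᴴ) (hL : L * X = 1)
    (hX' : W' = X' * X'ᴴ) :
    ∃ V : Matrix (H (2 * n + 1) × Fin k') (H (2 * n) × Fin k) ℂ, Vᴴ * V = 1 ∧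
      ∀ x y a, X' (x, y) a = ∑ c, V (y (Fin.last n), a) (x (Fin.last n), c) *
        X (fun i => x i.castSucc, fun i => y i.castSucc) c := by
  -- `Z` is X ⊗ 1 on the new input, with left inverse `K`. `Y` is `X'` with the new output counted
  -- as memory. The reduction hypothesis says that both purify the same operator.
  set Z : Matrix (InitIdx H n × H (2 * n)) (H (2 * n) × Fin k) ℂ :=
    Matrix.of fun r c => if r.2 = c.1 then X r.1 c.2 else 0 with hZ
  set Y : Matrix (InitIdx H n × H (2 * n)) (H (2 * n + 1) × Fin k') ℂ :=
    Matrix.of fun r c => X' (Fin.snoc (α := fun j : Fin (n + 1) => H (2 * j)) r.1.1 r.2,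
      Fin.snoc (α := fun j : Fin (n + 1) => H (2 * j + 1)) r.1.2 c.1) c.2 with hY
  set K : Matrix (H (2 * n) × Fin k) (InitIdx H n × H (2 * n)) ℂ :=
    Matrix.of fun c r => if r.2 = c.1 then L c.2 r.1 else 0 with hK
  have hYZ : Y * Yᴴ = Z * Zᴴ := by
    ext ⟨⟨x, y⟩, h⟩ ⟨⟨x', y'⟩, h'⟩
    have h1 := hW (Fin.snoc (α := fun j : Fin (n + 1) => H (2 * j)) x h)
      (Fin.snoc (α := fun j : Fin (n + 1) => H (2 * j)) x' h') y y'
    simp only [Fin.snoc_last, Fin.snoc_castSucc, hX, hX', Matrix.mul_apply,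
      Matrix.conjTranspose_apply] at h1
    rw [Matrix.mul_apply, Matrix.mul_apply, Fintype.sum_prod_type, Fintype.sum_prod_type]
    refine h1.trans ?_
    simp [hZ, apply_ite star]
  have hKZ : K * Z = 1 := by
    ext ⟨h, c⟩ ⟨h', c'⟩
    have h1 := congrFun (congrFun hL c) c'
    rw [Matrix.mul_apply] at h1
    rw [Matrix.mul_apply, Fintype.sum_prod_type, Finset.sum_comm]
    simp only [hK, hZ, Matrix.of_apply, ite_mul, zero_mul, mul_ite, mul_zero]
    by_cases hh : h = h'
    · simp [hh, h1, Matrix.one_apply]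
    · simp [hh, Ne.symm hh]
  obtain ⟨V, hV1, hV2⟩ := exists_coisometry hYZ hKZ
  -- `V` acts on memory indices from the right; as an operator from old to new memory it is
  -- transposed, and a co-isometry becomes an isometry.
  refine ⟨Vᵀ, ?_, fun x y a => ?_⟩
  · have := congrArg Matrix.transpose hV1
    rwa [Matrix.transpose_mul, Matrix.transpose_one] at this
  · have h1 := congrFun (congrFun hV2 ((fun i => x i.castSucc, fun i => y i.castSucc),
      x (Fin.last n))) (y (Fin.last n), a)
    have hx : Fin.snoc (α := fun j : Fin (n + 1) => H (2 * j)) (fun i => x i.castSucc)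
      (x (Fin.last n)) = x := Fin.snoc_init_self x
    have hy : Fin.snoc (α := fun j : Fin (n + 1) => H (2 * j + 1)) (fun i => y i.castSucc)
      (y (Fin.last n)) = y := Fin.snoc_init_self y
    simp only [hY, Matrix.of_apply, hx, hy] at h1
    rw [← h1, Matrix.mul_apply, Fintype.sum_prod_type]
    refine (Finset.sum_eq_single (x (Fin.last n)) ?_ ?_).trans ?_
    · intro b _ hb
      simp [hZ, hb.symm]
    · simp
    · simp [hZ, mul_comm]

/-- If the memories at both ends have dimension one and the total input and output dimensions agree,
then isometries between consecutive spaces preserve dimension. -/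
lemma dim_eq_of_dim_le {N : ℕ} {d e k : ℕ → ℕ} (hd : ∀ n, 0 < d n) (h0 : k 0 = 1)
    (h1 : k (N + 1) = 1) (hle : ∀ n ≤ N, d n * k n ≤ e n * k (n + 1))
    (hprod : ∏ n ∈ Finset.range (N + 1), d n = ∏ n ∈ Finset.range (N + 1), e n) :
    ∀ n ≤ N, d n * k n = e n * k (n + 1) := by
  have hk : ∀ n ≤ N + 1, 0 < k n := by
    intro n
    induction n with
    | zero => intro _; omega
    | succ n ih =>
      intro hn
      have := (Nat.mul_pos (hd n) (ih (by omega))).trans_le (hle n (by omega))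
      exact Nat.pos_of_mul_pos_left this
  by_contra! hne
  obtain ⟨m, hm, hm'⟩ := hne
  -- One strict inequality among positive factors makes the products differ, yet the products of the
  -- `k n` and of the `k (n + 1)` agree because both end values are 1.
  have hlt : ∏ n ∈ Finset.range (N + 1), d n * k n < ∏ n ∈ Finset.range (N + 1), e n * k (n + 1) :=
    Finset.prod_lt_prod
      (fun i hi => Nat.mul_pos (hd i) (hk i (by have := Finset.mem_range.1 hi; omega)))
      (fun i hi => hle i (by have := Finset.mem_range.1 hi; omega))
      ⟨m, Finset.mem_range.2 (by omega), (hle m hm).lt_of_ne hm'⟩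
  rw [Finset.prod_mul_distrib, Finset.prod_mul_distrib, hprod] at hlt
  have e1 := Finset.prod_range_succ k (N + 1)
  have e2 := Finset.prod_range_succ' k (N + 1)
  rw [e1, h0, h1, mul_one, mul_one] at e2
  rw [e2] at hlt
  exact lt_irrefl _ hlt

end QComb

/-! ### Factorization of the unitary into a circuit -/

theorem mainTheorem2 (N : ℕ) (hN : 1 ≤ N) (H : ℕ → Type)
    [∀ m, Fintype (H m)] [∀ m, DecidableEq (H m)] [∀ m, Nonempty (H m)]
    (U : Matrix (∀ n : Fin (N + 1), H (2 * n + 1)) (∀ n : Fin (N + 1), H (2 * n)) ℂ)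
    (hU : QComb.IsUnitaryOp U)
    (𝓡 : QComb.Supermap (H 0) (H (2 * N + 1))
      (fun j : Fin N => H (2 * j + 1)) (fun j : Fin N => H (2 * j + 2)))
    (h𝓡 : QComb.IsPureComb (QComb.supermapChoi 𝓡))
    (hrep : QComb.supermapChoi 𝓡 = QComb.choiOp (QComb.regroup U)) :
    ∃ (k : ℕ → ℕ)
      (V : ∀ n, Matrix (H (2 * n + 1) × Fin (k (n + 1))) (H (2 * n) × Fin (k n)) ℂ),
      k 0 = 1 ∧ k (N + 1) = 1 ∧
      (∀ n ≤ N, Fintype.card (H (2 * n)) * k n = Fintype.card (H (2 * n + 1)) * k (n + 1)) ∧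
      (∀ n ≤ N, QComb.IsUnitaryOp (V n)) ∧
      ∀ y x a, U y x = QComb.circuit V (N + 1) (y, a) x := by
  open QComb in
  obtain ⟨hpos, hseq⟩ := (combIffSequential N _ _ _ _ _).1 h𝓡.1
  rw [hrep] at hpos hseq
  have hsn : ∀ y : ∀ j : Fin (N + 1), H (2 * j + 1),
    Fin.snoc (α := fun j : Fin (N + 1) => H (2 * j + 1)) (fun j => y j.castSucc) (y (Fin.last N)) =
      y := fun y => Fin.snoc_init_self y
  have hcn : ∀ x : ∀ j : Fin (N + 1), H (2 * j),
    Fin.cons (α := fun j : Fin (N + 1) => H (2 * j)) (x 0) (fun j => x j.succ) = x :=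
      fun x => Fin.cons_self_tail x
  obtain ⟨W, hW1, hW2, hW3, hW4⟩ := exists_reductions N
    ((choiOp (regroup U)).submatrix
      (fun r : (H 0 × ∀ j : Fin N, H (2 * j + 2)) × ∀ j : Fin (N + 1), H (2 * j + 1) =>
        (r.1, ((fun j => r.2 j.castSucc), r.2 (Fin.last N))))
      (fun r => (r.1, ((fun j => r.2 j.castSucc), r.2 (Fin.last N)))))
    (hpos.submatrix _) (by
      refine (congrArg (Sequential N (H 0) _ _) ?_).mp hseq
      ext r s
      simp only [traceFuture, Matrix.of_apply, Matrix.submatrix_apply, Fin.snoc_castSucc,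
        Fin.snoc_last])
  have htop : W (N + 1) = (Matrix.of fun r (_ : Fin 1) => U r.2 r.1) *
      (Matrix.of fun r (_ : Fin 1) => U r.2 r.1)ᴴ := by
    rw [hW4]
    ext r s
    simp only [Matrix.submatrix_apply, splitFirst, choiOp, Matrix.vecMulVec_apply, choiVec,
      regroup, Pi.star_apply, Matrix.mul_apply, Matrix.of_apply, Matrix.conjTranspose_apply,
      Finset.univ_unique, Finset.sum_singleton, hsn, hcn]
  -- The end purifications are prescribed, with one-dimensional memory: the constant 1 at level 0
  -- and the entries of `U` at level `N + 1`. This makes the circuit equal `U` exactly, with no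
  -- leftover phase.
  have hex : ∀ n, ∃ (k : ℕ) (X : Matrix (InitIdx H n) (Fin k) ℂ)
      (L : Matrix (Fin k) (InitIdx H n) ℂ), W n = X * Xᴴ ∧ L * X = 1 ∧
      (n = 0 → k = 1 ∧ ∀ r c, X r c = 1) ∧
      (∀ h : n = N + 1, k = 1 ∧
        ∀ r c, X r c = U (h ▸ r : InitIdx H (N + 1)).2 (h ▸ r : InitIdx H (N + 1)).1) := by
    intro n
    by_cases h0 : n = 0
    · subst h0
      refine ⟨1, Matrix.of fun _ _ => 1, Matrix.of fun _ _ => 1, ?_, ?_, fun _ => ⟨rfl, fun _ _ => rfl⟩,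
        fun h => absurd h (by omega)⟩
      · rw [hW2]
        ext r s
        rw [Subsingleton.elim s r]
        simp [Matrix.mul_apply]
      · ext i j
        rw [Subsingleton.elim j i]
        simp [Matrix.mul_apply]
    by_cases h1 : n = N + 1
    · subst h1
      -- A single nonzero entry of `U` supplies a left inverse of the column of its entries.
      obtain ⟨r₀, hr₀⟩ : ∃ r : InitIdx H (N + 1), U r.2 r.1 ≠ 0 := by
        by_contra! hzero
        have hU0 : U = 0 := by
          ext y x; exact hzero (x, y)
        have := hU.1
        rw [hU0, Matrix.mul_zero] at this
        exact zero_ne_one this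
      refine ⟨1, Matrix.of fun r _ => U r.2 r.1,
        Matrix.of fun _ r => if r = r₀ then (U r₀.2 r₀.1)⁻¹ else 0, htop, ?_,
        fun h => absurd h (by omega), fun _ => ⟨rfl, fun _ _ => rfl⟩⟩
      ext i j
      rw [Subsingleton.elim j i, Matrix.mul_apply, Matrix.one_apply_eq]
      simp [hr₀]
    · obtain ⟨k, X, L, hX, hL⟩ := exists_purification (hW1 n)
      exact ⟨k, X, L, hX, hL, fun h => absurd h h0, fun h => absurd h h1⟩
  choose k X L hX hL hX0 hX1 using hex
  have hstep : ∀ n, ∃ V : Matrix (H (2 * n + 1) × Fin (k (n + 1))) (H (2 * n) × Fin (k n)) ℂ,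
      n ≤ N → Vᴴ * V = 1 ∧ ∀ x y a, X (n + 1) (x, y) a =
        ∑ c, V (y (Fin.last n), a) (x (Fin.last n), c) *
          X n (fun i => x i.castSucc, fun i => y i.castSucc) c := by
    intro n
    by_cases hn : n ≤ N
    · obtain ⟨V, hV⟩ := exists_step (hW3 n hn) (hX n) (hL n) (hX (n + 1))
      exact ⟨V, fun _ => hV⟩
    · exact ⟨0, fun h => absurd h hn⟩
  choose V hV using hstep
  -- The partial circuits are the purifications themselves, since both satisfy the same recursion.
  have hcirc : ∀ n ≤ N + 1, ∀ y a x, circuit V n (y, a) x = X n (x, y) a := by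
    intro n
    induction n with
    | zero => intro _ y a x; exact ((hX0 0 rfl).2 _ _).symm
    | succ n ih =>
      intro hn y a x
      rw [circuit_succ, (hV n (by omega)).2]
      exact Finset.sum_congr rfl fun c _ => by rw [ih (by omega)]
  have hk0 := (hX0 0 rfl).1
  have hk1 := (hX1 (N + 1) rfl).1
  have hdim := dim_eq_of_dim_le (N := N) (d := fun n => Fintype.card (H (2 * n)))
    (e := fun n => Fintype.card (H (2 * n + 1))) (k := k) (fun n => Fintype.card_pos) hk0 hk1
    (fun n hn => by simpa using card_le_of_isometry (hV n hn).1)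
    (by simpa [Fintype.card_pi, Finset.prod_range] using card_eq_of_isUnitaryOp hU)
  refine ⟨k, V, hk0, hk1, hdim, fun n hn => ⟨(hV n hn).1, ?_⟩, fun y x a => ?_⟩
  -- An isometry between spaces of equal dimension is unitary.
  · refine (Matrix.mul_eq_one_comm_of_card_eq _ _ _ ?_).1 (hV n hn).1
    simpa using hdim n hn
  · rw [hcirc (N + 1) le_rfl]
    exact ((hX1 (N + 1) rfl).2 (x, y) a).symm
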